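/- Let $\Omega\subset\mathbb{R}^2$ be a connected open set with $0\in\Omega$, and let $u:\Omega\to\mathbb{R}$ be real analytic. Write $\Delta u=u_{xx}+u_{yy}$, $\mathcal{H}(u)=\det D^2u=u_{xx}u_{yy}-u_{xy}^2$, and $J[f,g]=f_xg_y-f_yg_x$, and assume that $$J[\Delta u,\mathcal{H}(u)]=0\quad\text{on }\Omega.$$ Suppose that, with $\varrho=\sqrt{x^2+y^2}$, $$u(x,y)=\frac{\lambda}{2}(x^2+y^2)+w(x,y)+o(\varrho^k)\qquad\text{as }(x,y)\to(0,0),$$ where $\lambda\in\mathbb{R}$, $k\ge 3$, and $w$ is a real homogeneous polynomial of degree $k$ that is neither harmonic (so in particular $w\neq 0$) nor of the form $c(\alpha x+\beta y)^k$ with $c,\alpha,\beta\in\mathbb{R}$, $(\alpha,\beta)\ne(0,0)$. Then $u$ is radial: there is a function $h:\mathbb{R}\to\mathbb{R}$ such that $u(x,y)=h(\varrho)$ for all $(x,y)\in\Omega$. -/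

import Mathlib

open Filter Topology Asymptotics

noncomputable section

namespace RadialHessian

/-- The Euclidean plane. A point `p` has coordinates `x = p 0`, `y = p 1`, and its norm is
`ϱ = √(x² + y²)`. -/
abbrev Plane : Type := EuclideanSpace ℝ (Fin 2)

/-- The `i`-th partial derivative: `partialD 0 f = f_x` and `partialD 1 f = f_y`. -/
def partialD (i : Fin 2) (f : Plane → ℝ) (p : Plane) : ℝ :=
  fderiv ℝ f p (EuclideanSpace.single i 1)

/-- `det D²f = f_xx f_yy - f_xy²`. -/
def hessianDet (f : Plane → ℝ) (p : Plane) : ℝ :=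
  partialD 0 (partialD 0 f) p * partialD 1 (partialD 1 f) p
    - (partialD 1 (partialD 0 f) p) ^ 2

/-- The Jacobian `J[f, g] = f_x g_y - f_y g_x`. -/
def jacobian (f g : Plane → ℝ) (p : Plane) : ℝ :=
  partialD 0 f p * partialD 1 g p - partialD 1 f p * partialD 0 g p

/-- The function on the plane given by a polynomial in two variables. -/
def polyFun (w : MvPolynomial (Fin 2) ℝ) (p : Plane) : ℝ :=
  MvPolynomial.eval (fun i => p i) w

/-- `w` is a real constant times the `k`-th power of a nonzero linear form `α x + β y`. -/
def IsMultipleOfLinearPower (w : MvPolynomial (Fin 2) ℝ) (k : ℕ) : Prop :=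
  ∃ c α β : ℝ, (α, β) ≠ (0, 0) ∧
    w = MvPolynomial.C c *
      (MvPolynomial.C α * MvPolynomial.X 0 + MvPolynomial.C β * MvPolynomial.X 1) ^ k

end RadialHessian

end

/-! Adding a multiple of `x² + y²` to `u` changes `Δu` by a constant and `H(u)` by an affine
function of `Δu`, so the equation survives and the quadratic term may be removed. The leading form
`w` then satisfies `J[Δw, H(w)] = 0`. Since `Δw` and `H(w)` have degrees `k - 2` and `2 (k - 2)`,
Euler's relation turns this into `H(w) = c (Δw)²`.

In the variables `z`, `z̄` one has `Δ = 4 ∂_z ∂_z̄` and `H(w) = 4 (w_zz̄² - w_zz w_z̄z̄)`. Setting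
`z̄ = 1` gives an equation for one complex polynomial `p`. If `H(w) = 0`, then `w` is a power of a
linear form; otherwise counting root orders shows that `p''` has no root off the origin, and reality
of `w` leaves only `a (x² + y²)^j` (`exists_eq_C_mul_sq_add_sq_pow`).

Next compare `u` with a radial polynomial `R`. The leading form `q` of the difference, of degree `n
> 2j`, solves the equation linearised at `(x² + y²)^j`. With `∂_θ = x ∂_y - y ∂_x` this reads `(2j -
1) ∂_θ³ q = n (n - 2j) ∂_θ q`. As `∂_θ²` has no positive eigenvalue on forms, `∂_θ q = 0`. By
induction all Taylor polynomials are radial (`exists_radial_taylor`), so `∂_θ u` is flat at the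
origin and vanishes on `Ω` by analyticity.

A circle may meet `Ω` in several arcs, so `∂_θ u = 0` gives only local radiality. The profile near
the origin is therefore continued analytically in the radius (`exists_radial_profile`). -/

namespace RadialHessian

/-! ### Complex polynomial equations in one variable. -/

section Univariate

open Polynomial

/-- Two polynomials whose logarithmic derivatives satisfy `g'/g = 2 f'/f`. -/
theorem exists_eq_C_mul_sq_of_derivative {f g : ℂ[X]} (hf : f ≠ 0)
    (h : 2 * g * derivative f = f * derivative g) : ∃ c : ℂ, g = C c * f ^ 2 := by
  -- Multiplying by `X` preserves degrees, and comparing the coefficients in degree `deg f + deg G`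
  -- forces `deg G = 2 deg f`.
  have key : ∀ G : ℂ[X], 2 * G * derivative f = f * derivative G → G ≠ 0 →
      G.natDegree = 2 * f.natDegree := by
    intro G hG hG0
    have h1 := congrArg (fun q => q.coeff (f.natDegree + G.natDegree)) (congrArg (X * ·) hG)
    have e1 : X * (2 * G * derivative f) = C 2 * ((X * derivative f) * G) := by
      rw [show (C 2 : ℂ[X]) = 2 from rfl]; ring
    have e2 : X * (f * derivative G) = f * (X * derivative G) := by ring
    have d : ∀ q : ℂ[X], (X * derivative q).natDegree ≤ q.natDegree := by
      intro q
      by_cases hq : q.natDegree = 0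
      · rw [natDegree_eq_zero] at hq
        obtain ⟨c, rfl⟩ := hq
        simp
      · have := natDegree_derivative_lt hq
        refine (natDegree_mul_le).trans ?_
        rw [natDegree_X]; omega
    have c : ∀ q : ℂ[X], (X * derivative q).coeff q.natDegree = q.natDegree * q.leadingCoeff := by
      intro q
      cases hn : q.natDegree with
      | zero => simp
      | succ n =>
        rw [coeff_X_mul, coeff_derivative, leadingCoeff, hn]; push_cast; ring
    simp only [e1, e2, coeff_C_mul] at h1
    rw [coeff_mul_add_eq_of_natDegree_le (d f) le_rfl, coeff_mul_add_eq_of_natDegree_le le_rfl (d G), c, c] at h1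
    have hl : f.leadingCoeff * G.leadingCoeff ≠ 0 :=
      mul_ne_zero (leadingCoeff_ne_zero.2 hf) (leadingCoeff_ne_zero.2 hG0)
    have h2 : ((G.natDegree : ℂ) - (2 * f.natDegree : ℕ)) * (f.leadingCoeff * G.leadingCoeff) = 0 := by
      push_cast
      simp only [leadingCoeff] at h1 ⊢
      linear_combination -h1
    have h3 := (mul_eq_zero.1 h2).resolve_right hl
    exact_mod_cast sub_eq_zero.1 h3
  by_cases hg : g = 0
  · exact ⟨0, by simp [hg]⟩
  have hd := key g h hg
  -- This `c` cancels the top coefficient. As `g - c f²` solves the same linear equation, it would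
  -- have degree exactly `2 deg f` if it were nonzero.
  set c := g.leadingCoeff / f.leadingCoeff ^ 2 with hc
  refine ⟨c, ?_⟩
  by_contra hne
  have hne' : g - C c * f ^ 2 ≠ 0 := sub_ne_zero.2 hne
  have h2 : 2 * (g - C c * f ^ 2) * derivative f = f * derivative (g - C c * f ^ 2) := by
    simp only [derivative_sub, derivative_mul, derivative_C, derivative_pow]
    simp only [Nat.cast_ofNat, show (C (2 : ℂ) : ℂ[X]) = 2 from rfl]
    linear_combination h
  have hd2 := key _ h2 hne'
  have hl : f.leadingCoeff ≠ 0 := leadingCoeff_ne_zero.2 hf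
  have hc0 : c ≠ 0 := div_ne_zero (leadingCoeff_ne_zero.2 hg) (pow_ne_zero _ hl)
  have hz : (g - C c * f ^ 2).coeff (2 * f.natDegree) = 0 := by
    have e : (f ^ 2).coeff (2 * f.natDegree) = f.leadingCoeff ^ 2 := by
      rw [coeff_pow_mul_natDegree]
    rw [coeff_sub, coeff_C_mul, e, ← hd, coeff_natDegree, hc]
    field_simp; ring
  rw [← hd2, coeff_natDegree, leadingCoeff_eq_zero] at hz
  exact hne' hz

/-- `(k - 1) p' - X p''`, which is `∂_z ∂_z̄` of the form of degree `k` dehomogenised to `p`. -/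
noncomputable def mixedPart (k : ℕ) (p : ℂ[X]) : ℂ[X] :=
  C ((k : ℂ) - 1) * derivative p - X * derivative (derivative p)

/-- `k (k - 1) p - 2 (k - 1) X p' + X² p''`, which is `∂_z̄²` of the form of degree `k`
dehomogenised to `p`. -/
noncomputable def conjPart (k : ℕ) (p : ℂ[X]) : ℂ[X] :=
  C ((k : ℂ) * (k - 1)) * p - C (2 * ((k : ℂ) - 1)) * (X * derivative p)
    + X ^ 2 * derivative (derivative p)

/-- All terms in `X` cancel. The left side is a quarter of the dehomogenised Hessian determinant, so
this governs both the root count and the degenerate case `H(w) = 0`. -/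
theorem mixedPart_sq_sub (k : ℕ) (p : ℂ[X]) :
    mixedPart k p ^ 2 - derivative (derivative p) * conjPart k p
      = C (((k : ℂ) - 1) ^ 2) * derivative p ^ 2
        - C ((k : ℂ) * (k - 1)) * (p * derivative (derivative p)) := by
  simp only [mixedPart, conjPart, map_mul, map_sub, map_pow, map_one, map_natCast,
    show (C (2 : ℂ) : ℂ[X]) = 2 from rfl]
  ring

/-- The factor is that of a second derivative with `l` replaced by `k - l`: `conjPart` mirrors `p''`
under the exchange of `z` and `z̄`. -/
theorem coeff_conjPart (k : ℕ) (p : ℂ[X]) (l : ℕ) :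
    (conjPart k p).coeff l = ((k : ℂ) - l) * (k - l - 1) * p.coeff l := by
  have h1 : (X * derivative p).coeff l = l * p.coeff l := by
    cases l with
    | zero => simp
    | succ n => rw [coeff_X_mul, coeff_derivative]; push_cast; ring
  have h2 : (X ^ 2 * derivative (derivative p)).coeff l = l * (l - 1) * p.coeff l := by
    rcases l with _ | _ | n
    · simp [pow_two, mul_assoc]
    · simp [pow_two, mul_assoc]
    · rw [pow_two, mul_assoc, coeff_X_mul, coeff_X_mul, coeff_derivative,
        coeff_derivative]
      push_cast; ring
  rw [conjPart, coeff_add, coeff_sub, coeff_C_mul, coeff_C_mul, h1, h2]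
  ring

/-- Suppose `p''` has a root `t ≠ 0` of order `e`. Then `mixedPart` vanishes at `t`, hence so does
`p'`, to order `e + 1`. The identity `mixedPart_sq_sub` then forces `p t = 0`, so `p` has order `e +
2`; divided by `(X - t)^(2e)` and evaluated at `t`, the identity leaves `(1 - c) t² g(t)² = 0` with
`g(t) ≠ 0`. -/
theorem derivative_derivative_eval_ne_zero {k : ℕ} (hk : 3 ≤ k) {p : ℂ[X]} {c : ℂ} (hc0 : c ≠ 0)
    (hc1 : c ≠ 1) (hp : derivative (derivative p) ≠ 0)
    (h : derivative (derivative p) * conjPart k p = C c * mixedPart k p ^ 2) {t : ℂ} (ht : t ≠ 0) :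
    (derivative (derivative p)).eval t ≠ 0 := by
  intro h0
  have hk0 : (k : ℂ) ≠ 0 := by norm_cast; omega
  have hk1 : (k : ℂ) - 1 ≠ 0 := by
    rw [sub_ne_zero]; norm_cast; omega
  have hS : (mixedPart k p).eval t = 0 := by
    have := congrArg (eval t) h
    simp only [eval_mul, eval_pow, eval_C, h0, zero_mul] at this
    simpa [hc0] using this.symm
  have hp' : (derivative p).eval t = 0 := by
    simp only [mixedPart, eval_sub, eval_mul, eval_C, eval_X, h0, mul_zero, sub_zero] at hS
    exact (mul_eq_zero.1 hS).resolve_left hk1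
  have hp'0 : derivative p ≠ 0 := by rintro h; simp [h] at hp
  have hp0 : p ≠ 0 := by rintro h; simp [h] at hp
  set e := (derivative (derivative p)).rootMultiplicity t with he
  have he1 : 0 < e := (rootMultiplicity_pos hp).2 h0
  have hm' : (derivative p).rootMultiplicity t = e + 1 := by
    have := derivative_rootMultiplicity_of_root (p := derivative p) (t := t) hp'
    have h2 := (rootMultiplicity_pos hp'0).2 hp'
    omega
  obtain ⟨g, hg, hgd⟩ := exists_eq_pow_rootMultiplicity_mul_and_not_dvd _ hp t
  obtain ⟨q, hq⟩ := pow_rootMultiplicity_dvd (derivative p) t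
  rw [hm'] at hq
  rw [← he] at hg
  have hgt : g.eval t ≠ 0 := by rwa [Ne, ← IsRoot, ← dvd_iff_isRoot]
  have key := mixedPart_sq_sub k p
  rw [h] at key
  have hS' : mixedPart k p = (X - C t) ^ e * (C ((k : ℂ) - 1) * ((X - C t) * q) - X * g) := by
    rw [mixedPart, hg, hq]; ring
  rw [hS', hg, hq] at key
  have key2 : C ((k : ℂ) * (k - 1)) * p * g = (X - C t) ^ e *
      (C (((k : ℂ) - 1) ^ 2) * ((X - C t) * q) ^ 2
        - C (1 - c) * (C ((k : ℂ) - 1) * ((X - C t) * q) - X * g) ^ 2) := by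
    have : (X - C t) ^ e ≠ 0 := pow_ne_zero _ (X_sub_C_ne_zero t)
    apply mul_left_cancel₀ this
    rw [C_sub, C_1]
    linear_combination key
  have hpt : p.eval t = 0 := by
    have := congrArg (eval t) key2
    simp only [eval_mul, eval_pow, eval_sub, eval_X, eval_C, sub_self, zero_pow he1.ne',
      zero_mul] at this
    simpa [hk0, hk1, hgt] using this
  have hmp : p.rootMultiplicity t = e + 2 := by
    have := derivative_rootMultiplicity_of_root (p := p) (t := t) hpt
    have h2 := (rootMultiplicity_pos hp0).2 hpt
    omega
  obtain ⟨r, hr⟩ := pow_rootMultiplicity_dvd p t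
  rw [hmp] at hr
  have key3 : C ((k : ℂ) * (k - 1)) * ((X - C t) ^ 2 * r) * g =
      (C (((k : ℂ) - 1) ^ 2) * ((X - C t) * q) ^ 2
        - C (1 - c) * (C ((k : ℂ) - 1) * ((X - C t) * q) - X * g) ^ 2) := by
    have : (X - C t) ^ e ≠ 0 := pow_ne_zero _ (X_sub_C_ne_zero t)
    apply mul_left_cancel₀ this
    rw [← key2]
    nth_rewrite 1 [hr]
    ring
  have := congrArg (eval t) key3
  simp only [eval_mul, eval_pow, eval_sub, eval_X, eval_C, sub_self] at this
  have h3 : (1 - c) * (t * g.eval t) ^ 2 = 0 := by linear_combination this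
  have h4 : (1 - c) ≠ 0 := sub_ne_zero.2 (Ne.symm hc1)
  simp [h4, ht, hgt] at h3

/-- A complex polynomial without nonzero roots is a monomial. -/
theorem exists_eq_C_mul_X_pow {p : ℂ[X]} (h : ∀ t ≠ 0, p.eval t ≠ 0) :
    ∃ (c : ℂ) (n : ℕ), p = C c * X ^ n := by
  have hp : p ≠ 0 := by rintro rfl; exact h 1 one_ne_zero (by simp)
  obtain ⟨g, hg, hgd⟩ := exists_eq_pow_rootMultiplicity_mul_and_not_dvd p hp 0
  rw [C_0, sub_zero] at hg hgd
  have hdeg : g.degree = 0 := by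
    by_contra hd
    obtain ⟨t, ht⟩ := IsAlgClosed.exists_root g hd
    by_cases ht0 : t = 0
    · subst ht0
      rw [← dvd_iff_isRoot, C_0, sub_zero] at ht
      exact hgd ht
    · apply h t ht0
      rw [hg, eval_mul, ht.eq_zero, mul_zero]
  obtain ⟨c, hc⟩ := natDegree_eq_zero.1 (natDegree_eq_of_degree_eq_some hdeg)
  exact ⟨c, p.rootMultiplicity 0, by rw [← hc] at hg; rw [mul_comm]; exact hg⟩

/-- Palindromic-conjugate polynomials with `p'' Q = c S²` and `c ≠ 1`. -/
theorem eq_C_mul_X_pow_of_conj_symm {k : ℕ} (hk : 3 ≤ k) {p : ℂ[X]} {c : ℂ} (hc1 : c ≠ 1)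
    (hsymm : ∀ i j, i + j = k → p.coeff i = starRingEnd ℂ (p.coeff j))
    (hdeg : p.natDegree ≤ k) (hS : mixedPart k p ≠ 0)
    (h : derivative (derivative p) * conjPart k p = C c * mixedPart k p ^ 2) :
    ∃ (a : ℂ) (j : ℕ), 2 * j = k ∧ p = C a * X ^ j := by
  have hcoef : ∀ l, (derivative (derivative p)).coeff l
      = ((l : ℂ) + 2) * (l + 1) * p.coeff (l + 2) := by
    intro l; rw [coeff_derivative, coeff_derivative]; push_cast; ring
  have hbig : ∀ l, k < l → p.coeff l = 0 := fun l hl =>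
    coeff_eq_zero_of_natDegree_lt (by omega)
  have hconj0 : ∀ i j, i + j = k → p.coeff i = 0 → p.coeff j = 0 := by
    intro i j hij h0
    rw [hsymm j i (by omega), h0, map_zero]
  -- the second derivative does not vanish
  have hp2 : derivative (derivative p) ≠ 0 := by
    intro h2
    apply hS
    have hz : ∀ l, 2 ≤ l → p.coeff l = 0 := by
      intro l hl
      have := hcoef (l - 2)
      rw [h2, coeff_zero, show l - 2 + 2 = l by omega] at this
      have e1 : ((l - 2 : ℕ) : ℂ) + 2 ≠ 0 := by norm_cast
      have e2 : ((l - 2 : ℕ) : ℂ) + 1 ≠ 0 := by norm_cast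
      simpa [e1, e2] using this.symm
    have : p = 0 := by
      ext l
      rw [coeff_zero]
      by_cases hl : 2 ≤ l
      · exact hz l hl
      · exact hconj0 (k - l) l (by omega) (hz _ (by omega))
    simp [mixedPart, this]
  -- For `c = 0` the factor `conjPart` would vanish, and by the conjugation symmetry so would its
  -- mirror image `p''`.
  have hc0 : c ≠ 0 := by
    rintro rfl
    rw [C_0, zero_mul] at h
    have hQ := (mul_eq_zero.1 h).resolve_left hp2
    apply hp2
    ext l
    rw [hcoef, coeff_zero]
    by_cases hl : l + 2 ≤ k
    · have h1 := coeff_conjPart k p (k - (l + 2))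
      rw [hQ, coeff_zero, Nat.cast_sub hl] at h1
      have e1 : ((k : ℂ) - (k - ((l + 2 : ℕ) : ℂ))) ≠ 0 := by
        rw [sub_sub_cancel]; norm_cast
      have e2 : ((k : ℂ) - (k - ((l + 2 : ℕ) : ℂ)) - 1) ≠ 0 := by
        rw [sub_sub_cancel]; push_cast
        rw [show (l : ℂ) + 2 - 1 = ((l + 1 : ℕ) : ℂ) by push_cast; ring]; norm_cast
      have h2 := (mul_eq_zero.1 h1.symm).resolve_left (mul_ne_zero e1 e2)
      rw [hconj0 (k - (l + 2)) (l + 2) (by omega) h2, mul_zero]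
    · rw [hbig _ (by omega), mul_zero]
  obtain ⟨α, n, hα⟩ := exists_eq_C_mul_X_pow
    (fun t ht => derivative_derivative_eval_ne_zero hk hc0 hc1 hp2 h ht)
  -- Since `p''` is a multiple of `X ^ n`, only the coefficients of `p` at `0`, `1` and `n + 2` can
  -- survive.
  have hz : ∀ l, 2 ≤ l → l ≠ n + 2 → p.coeff l = 0 := by
    intro l hl hne
    have := hcoef (l - 2)
    rw [hα, coeff_C_mul, coeff_X_pow, show l - 2 + 2 = l by omega, if_neg (by omega),
      mul_zero] at this
    have e1 : ((l - 2 : ℕ) : ℂ) + 2 ≠ 0 := by norm_cast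
    have e2 : ((l - 2 : ℕ) : ℂ) + 1 ≠ 0 := by norm_cast
    simpa [e1, e2] using this.symm
  have hn : p.coeff (n + 2) ≠ 0 := by
    intro h0
    apply hp2
    ext l
    rw [hcoef, coeff_zero]
    by_cases hl : l = n
    · rw [hl, h0, mul_zero]
    · rw [hz _ (by omega) (by omega), mul_zero]
  have hnk : n + 2 ≤ k := by
    by_contra hlt
    exact hn (hbig _ (by omega))
  have hn' : p.coeff (k - (n + 2)) ≠ 0 := fun h0 => hn (hconj0 _ _ (by omega) h0)
  by_cases hmid : k - (n + 2) = n + 2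
  · refine ⟨p.coeff (n + 2), n + 2, by omega, ?_⟩
    ext l
    rw [coeff_C_mul, coeff_X_pow]
    split_ifs with hl
    · rw [hl, mul_one]
    rw [mul_zero]
    by_cases hl2 : 2 ≤ l
    · exact hz l hl2 hl
    · exact hconj0 (k - l) l (by omega) (hz _ (by omega) (by omega))
  exfalso
  -- By symmetry the coefficient at `k - (n + 2)` is nonzero too; off the middle it must be the one
  -- at `0` or `1`.
  have hlow : k - (n + 2) < 2 := by
    by_contra hge
    exact hn' (hz _ (by omega) hmid)
  -- the remaining cases are excluded by evaluation
  have hS0 : mixedPart k p = 0 ∨ k = n + 3 := by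
    by_cases hkn : k = n + 3
    · exact Or.inr hkn
    left
    -- Here `p = a + b X ^ k` comes from the harmonic form `a z̄^k + b z^k`, on which `∂_z ∂_z̄`
    -- vanishes.
    have hkn2 : k = n + 2 := by omega
    have h1 : p.coeff 1 = 0 := hconj0 (k - 1) 1 (by omega) (hz _ (by omega) (by omega))
    have hpe : p = C (p.coeff 0) + C (p.coeff k) * X ^ k := by
      ext l
      rw [coeff_add, coeff_C_mul, coeff_X_pow, coeff_C]
      by_cases hl0 : l = 0
      · subst hl0; rw [if_pos rfl, if_neg (by omega)]; ring
      rw [if_neg hl0]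
      split_ifs with hl
      · rw [hl]; ring
      rw [mul_zero, add_zero]
      by_cases hl1 : l = 1
      · rw [hl1, h1]
      · exact hz l (by omega) (by omega)
    rw [hpe, mixedPart]
    obtain ⟨m, rfl⟩ : ∃ m, k = m + 2 := ⟨n, hkn2⟩
    simp only [derivative_add, derivative_C, derivative_mul, derivative_X_pow, zero_mul, zero_add]
    simp only [Nat.cast_add, Nat.cast_ofNat, Nat.add_sub_cancel, map_add, map_sub, map_one,
      map_natCast, show m + 2 - 1 = m + 1 by omega, 
      show (C (2 : ℂ) : ℂ[X]) = 2 from rfl, Nat.cast_one]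
    ring
  rcases hS0 with h0 | hkn
  · exact hS h0
  -- At `0` the left side vanishes because `p.coeff 0` is conjugate to `p.coeff k = 0`, while the
  -- right side is a nonzero multiple of `p.coeff 1 ^ 2`.
  · have e := congrArg (eval 0) h
    simp only [eval_mul, eval_pow, eval_C] at e
    have e1 : (conjPart k p).eval 0 = 0 := by
      rw [← coeff_zero_eq_eval_zero, coeff_conjPart, hconj0 k 0 (by omega)
        (hz _ (by omega) (by omega)), mul_zero]
    have e2 : (mixedPart k p).eval 0 = ((k : ℂ) - 1) * p.coeff 1 := by
      simp only [mixedPart, eval_sub, eval_mul, eval_C, eval_X, zero_mul, sub_zero]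
      rw [← coeff_zero_eq_eval_zero, coeff_derivative]; simp
    rw [e1, e2, mul_zero] at e
    have hk1 : (k : ℂ) - 1 ≠ 0 := by
      rw [sub_ne_zero]; norm_cast; omega
    rw [show k - (n + 2) = 1 by omega] at hn'
    simp [hc0, hk1, hn'] at e

/-- The equation `k p p'' = (k - 1) p'²` has only `k`-th powers of linear polynomials as
nonconstant solutions of degree at most `k`. -/
theorem eq_C_mul_X_sub_C_pow {k : ℕ} {p : ℂ[X]} (hp : derivative p ≠ 0)
    (hdeg : p.natDegree ≤ k)
    (h : C (k : ℂ) * (p * derivative (derivative p)) = C ((k : ℂ) - 1) * derivative p ^ 2) :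
    ∃ a t : ℂ, p = C a * (X - C t) ^ k := by
  have hp0 : p ≠ 0 := by rintro rfl; simp at hp
  have hd : p.degree ≠ 0 := by
    intro hd
    obtain ⟨c, hc⟩ := natDegree_eq_zero.1 (natDegree_eq_of_degree_eq_some hd)
    rw [← hc, derivative_C] at hp
    exact hp rfl
  obtain ⟨t, ht⟩ := IsAlgClosed.exists_root p hd
  have hm0 := (rootMultiplicity_pos hp0).2 ht
  obtain ⟨g, hg, hgd⟩ := exists_eq_pow_rootMultiplicity_mul_and_not_dvd p hp0 t
  set m := p.rootMultiplicity t with hm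
  have hgt : g.eval t ≠ 0 := by rwa [Ne, ← IsRoot, ← dvd_iff_isRoot]
  -- Multiplying derivatives by powers of `X - t` avoids the exponents `m - 1` and `m - 2`.
  have h1 : (X - C t) * derivative p = (X - C t) ^ m * (C (m : ℂ) * g + (X - C t) * derivative g) := by
    obtain ⟨n, hn⟩ : ∃ n, m = n + 1 := ⟨m - 1, by omega⟩
    rw [hg, hn, derivative_mul, derivative_X_sub_C_pow]
    simp only [Nat.add_sub_cancel, map_natCast]
    ring
  have h2 : (X - C t) ^ 2 * derivative (derivative p) = (X - C t) ^ m *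
      (C (m * (m - 1) : ℂ) * g + C (2 * m : ℂ) * ((X - C t) * derivative g)
        + (X - C t) ^ 2 * derivative (derivative g)) := by
    have h3 := congrArg (fun q => (X - C t) * derivative q) h1
    obtain ⟨n, hn⟩ : ∃ n, m = n + 1 := ⟨m - 1, by omega⟩
    rw [hn] at h3 h1 ⊢
    simp only [derivative_mul, derivative_X_sub_C_pow, derivative_sub, derivative_X,
      derivative_C, derivative_add] at h3
    simp only [Nat.add_sub_cancel, map_natCast, map_sub, map_mul, map_one,
      show (C (2 : ℂ) : ℂ[X]) = 2 from rfl] at h3 h1 ⊢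
    push_cast at h3 h1 ⊢
    linear_combination h3 - h1
  have key : C (k : ℂ) * (g * (C (m * (m - 1) : ℂ) * g + C (2 * m : ℂ) * ((X - C t) * derivative g)
        + (X - C t) ^ 2 * derivative (derivative g)))
      = C ((k : ℂ) - 1) * (C (m : ℂ) * g + (X - C t) * derivative g) ^ 2 := by
    have : (X - C t) ^ (m + m) ≠ 0 := pow_ne_zero _ (X_sub_C_ne_zero t)
    apply mul_left_cancel₀ this
    have h4 : C (k : ℂ) * (p * ((X - C t) ^ 2 * derivative (derivative p)))
        = C ((k : ℂ) - 1) * ((X - C t) * derivative p) ^ 2 := by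
      linear_combination (X - C t) ^ 2 * h
    rw [h1, h2] at h4
    nth_rewrite 1 [hg] at h4
    linear_combination h4
  have e := congrArg (eval t) key
  simp only [eval_mul, eval_pow, eval_sub, eval_add, eval_X, eval_C, sub_self] at e
  -- At the root the equation reads `k m (m - 1) = (k - 1) m²`, that is `m = k`; the degree bound
  -- then makes `g` constant.
  have hmk : ((m : ℂ) * ((m : ℂ) - k)) * g.eval t ^ 2 = 0 := by linear_combination e
  have hmk' : m = k := by
    have h5 := (mul_eq_zero.1 hmk).resolve_right (pow_ne_zero _ hgt)
    have h6 : (m : ℂ) ≠ 0 := by exact_mod_cast hm0.ne'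
    exact_mod_cast sub_eq_zero.1 ((mul_eq_zero.1 h5).resolve_left h6)
  have hg0 : g.natDegree = 0 := by
    have hgne : g ≠ 0 := by rintro rfl; simp at hgt
    have := congrArg natDegree hg
    rw [natDegree_mul (pow_ne_zero _ (X_sub_C_ne_zero t)) hgne, natDegree_pow,
      natDegree_X_sub_C] at this
    omega
  obtain ⟨a, ha⟩ := natDegree_eq_zero.1 hg0
  exact ⟨a, t, by rw [ha, ← hmk', mul_comm]; exact hg⟩

end Univariate

/-! ### Real forms as complex polynomials in one variable. -/

section Dehomogenisation

open Polynomial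
open MvPolynomial (pderiv)

/-- The substitution `x = (t + 1) / 2`, `y = (t - 1) / (2 i)`, that is `z = t`, `z̄ = 1`. -/
noncomputable def dehom : MvPolynomial (Fin 2) ℝ →ₐ[ℝ] ℂ[X] :=
  MvPolynomial.aeval ![C (1 / 2) * (X + 1), C (-Complex.I / 2) * (X - 1)]

@[simp] theorem dehom_X_zero : dehom (MvPolynomial.X 0) = C (1 / 2) * (X + 1) := by
  simp [dehom]

@[simp] theorem dehom_X_one : dehom (MvPolynomial.X 1) = C (-Complex.I / 2) * (X - 1) := by
  simp [dehom]

@[simp] theorem dehom_C (r : ℝ) : dehom (MvPolynomial.C r) = C (r : ℂ) := by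
  simp [dehom, Polynomial.algebraMap_apply]

/-- Chain rule: differentiation in `t` is `∂_z = (∂_x - i ∂_y) / 2`. -/
theorem derivative_dehom (w : MvPolynomial (Fin 2) ℝ) :
    derivative (dehom w) = C (1 / 2) * dehom (pderiv 0 w) + C (-Complex.I / 2) * dehom (pderiv 1 w) := by
  induction w using MvPolynomial.induction_on with
  | C a => simp
  | add p q hp hq => simp only [map_add, hp, hq]; ring
  | mul_X p i hp =>
    fin_cases i <;>
    · simp [MvPolynomial.pderiv_X, hp]
      ring

theorem euler {w : MvPolynomial (Fin 2) ℝ} {n : ℕ} (hw : w.IsHomogeneous n) :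
    MvPolynomial.X 0 * pderiv 0 w + MvPolynomial.X 1 * pderiv 1 w = (n : MvPolynomial (Fin 2) ℝ) * w := by
  have := hw.sum_X_mul_pderiv
  rwa [Fin.sum_univ_two, nsmul_eq_mul] at this

theorem aeval_smul_of_isHomogeneous {w : MvPolynomial (Fin 2) ℝ} {n : ℕ} (hw : w.IsHomogeneous n)
    (c : ℂ) (v : Fin 2 → ℂ) :
    MvPolynomial.aeval (c • v) w = c ^ n * MvPolynomial.aeval v w := by
  rw [MvPolynomial.aeval_def, MvPolynomial.aeval_def, MvPolynomial.eval₂_eq', MvPolynomial.eval₂_eq',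
    Finset.mul_sum]
  refine Finset.sum_congr rfl fun d hd => ?_
  have hdeg := hw.degree_eq_sum_deg_support hd
  simp only [Pi.smul_apply, smul_eq_mul, mul_pow, Finset.prod_mul_distrib, Finset.prod_pow_eq_pow_sum]
  have : ∑ i, d i = n := by
    rw [hdeg]
    symm
    exact Finset.sum_subset (Finset.subset_univ _) (fun i _ hi => by simpa using hi)
  rw [this]; ring

theorem eval_dehom (w : MvPolynomial (Fin 2) ℝ) (t : ℂ) :
    (dehom w).eval t = MvPolynomial.aeval ![(t + 1) / 2, -Complex.I / 2 * (t - 1)] w := by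
  induction w using MvPolynomial.induction_on with
  | C a => simp
  | add p q hp hq => simp only [map_add, eval_add, hp, hq]
  | mul_X p i hp =>
    fin_cases i
    · simp [hp]
      left; ring
    · simp [hp]

/-- The point `(x, y)` is `z̄` times the complex point with coordinates `z / z̄` and `1`, so
homogeneity recovers the values of `w` from `dehom w`. -/
theorem eval_eq_conj_pow_mul_eval_dehom {w : MvPolynomial (Fin 2) ℝ} {n : ℕ}
    (hw : w.IsHomogeneous n) {z : ℂ} (hz : z ≠ 0) :
    ((MvPolynomial.eval ![z.re, z.im] w : ℝ) : ℂ)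
      = starRingEnd ℂ z ^ n * (dehom w).eval (z / starRingEnd ℂ z) := by
  have hz' : starRingEnd ℂ z ≠ 0 := by simpa using hz
  rw [eval_dehom, ← aeval_smul_of_isHomogeneous hw]
  have e : (starRingEnd ℂ z • ![(z / starRingEnd ℂ z + 1) / 2,
      -Complex.I / 2 * (z / starRingEnd ℂ z - 1)]) = fun i => ((![z.re, z.im] i : ℝ) : ℂ) := by
    have hre : starRingEnd ℂ z = z.re - z.im * Complex.I := by
      apply Complex.ext <;> simp
    have hzz : z = z.re + z.im * Complex.I := (Complex.re_add_im z).symm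
    ext i
    fin_cases i
    · simp only [Fin.zero_eta, Pi.smul_apply, Matrix.cons_val_zero, smul_eq_mul]
      rw [show starRingEnd ℂ z * ((z / starRingEnd ℂ z + 1) / 2) = (z + starRingEnd ℂ z) / 2 by
        field_simp, hre]
      nth_rewrite 1 [hzz]
      ring
    · simp only [Fin.mk_one, Pi.smul_apply, Matrix.cons_val_one, smul_eq_mul,
        Matrix.cons_val_fin_one]
      rw [show starRingEnd ℂ z * (-Complex.I / 2 * (z / starRingEnd ℂ z - 1))
        = -Complex.I / 2 * (z - starRingEnd ℂ z) by field_simp, hre]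
      nth_rewrite 1 [hzz]
      linear_combination -(z.im : ℂ) * Complex.I_sq
  rw [e]
  have h2 := MvPolynomial.eval₂_comp_left (Complex.ofRealHom) (RingHom.id ℝ) ![z.re, z.im] w
  rw [MvPolynomial.aeval_def]
  exact h2

/-- Both forms take real values, so only the real part of `c` matters. In particular `dehom` is
injective on forms of a given degree. -/
theorem eq_C_re_mul_of_dehom_eq {w v : MvPolynomial (Fin 2) ℝ} {n : ℕ} (hw : w.IsHomogeneous n)
    (hv : v.IsHomogeneous n) {c : ℂ} (h : dehom w = C c * dehom v) :
    w = MvPolynomial.C c.re * v := by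
  have hcv : (MvPolynomial.C c.re * v).IsHomogeneous n := hv.C_mul _
  have main : ∀ r : Fin 2 → ℝ, r ≠ 0 →
      MvPolynomial.eval r w = MvPolynomial.eval r (MvPolynomial.C c.re * v) := by
    intro r hr
    set z : ℂ := ⟨r 0, r 1⟩ with hz
    have hr' : r = ![z.re, z.im] := by ext i; fin_cases i <;> rfl
    have hz0 : z ≠ 0 := by
      intro h0
      apply hr
      rw [hr', h0]
      ext i; fin_cases i <;> rfl
    have h1 := eval_eq_conj_pow_mul_eval_dehom hw hz0
    have h2 := eval_eq_conj_pow_mul_eval_dehom hv hz0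
    rw [h, eval_mul, eval_C] at h1
    have h3 : ((MvPolynomial.eval ![z.re, z.im] w : ℝ) : ℂ)
        = c * ((MvPolynomial.eval ![z.re, z.im] v : ℝ) : ℂ) := by rw [h1, h2]; ring
    have h4 := congrArg Complex.re h3
    rw [Complex.ofReal_re, Complex.re_mul_ofReal] at h4
    rw [hr', h4]; simp
  -- Agreement is known only off the origin; the factor `X 0` extends it to every point.
  have hX : MvPolynomial.X 0 * w = MvPolynomial.X 0 * (MvPolynomial.C c.re * v) := by
    apply MvPolynomial.funext
    intro r
    by_cases hr : r = 0
    · simp [hr]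
    · rw [map_mul, map_mul, main r hr]
  exact mul_left_cancel₀ (MvPolynomial.X_ne_zero 0) hX

theorem eq_zero_of_dehom_eq_zero {w : MvPolynomial (Fin 2) ℝ} {n : ℕ} (hw : w.IsHomogeneous n)
    (h : dehom w = 0) : w = 0 := by
  have := eq_C_re_mul_of_dehom_eq hw hw (c := 0) (by simp [h])
  simpa using this

theorem natDegree_dehom_le {w : MvPolynomial (Fin 2) ℝ} {n : ℕ} (hw : w.IsHomogeneous n) :
    (dehom w).natDegree ≤ n := by
  have h := MvPolynomial.aeval_natDegree_le (m := n) (n := 1)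
    (MvPolynomial.map (algebraMap ℝ ℂ) w) ((hw.map _).totalDegree_le)
    ![C (1 / 2) * (X + 1), C (-Complex.I / 2) * (X - 1)] (by
      intro i
      fin_cases i
      · exact (natDegree_C_mul_le _ _).trans (by
          rw [← C_1, natDegree_X_add_C])
      · exact (natDegree_C_mul_le _ _).trans (by
          rw [← C_1, natDegree_X_sub_C]))
  rw [MvPolynomial.aeval_map_algebraMap, mul_one] at h
  exact h

/-- Reality of `w`: the coefficients of `z^i z̄^j` and `z^j z̄^i` are conjugate. The equality is
verified on the unit circle, an infinite set. -/
theorem coeff_dehom_conj {w : MvPolynomial (Fin 2) ℝ} {n : ℕ} (hw : w.IsHomogeneous n)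
    {i j : ℕ} (hij : i + j = n) :
    (dehom w).coeff i = starRingEnd ℂ ((dehom w).coeff j) := by
  set p := dehom w with hp
  have key : p = reflect n (p.map (starRingEnd ℂ)) := by
    have hinf : Set.Infinite (Metric.sphere (0 : ℂ) 1) := by
      refine (isPreconnected_sphere (by simp [Complex.rank_real_complex]) 0 1).infinite_of_nontrivial
        ⟨1, by simp, -1, by simp, ?_⟩
      norm_num
    apply eq_of_infinite_eval_eq
    apply hinf.mono
    intro t ht
    have htn : ‖t‖ = 1 := by simpa using ht
    have ht0 : t ≠ 0 := by rintro rfl; simp at htn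
    -- A square root `s` of `t` satisfies `s / s̄ = t`, so `s̄^n p(t)` is the real number `w(s)`.
    obtain ⟨s, hs⟩ := IsAlgClosed.exists_pow_nat_eq t (n := 2) (by norm_num)
    have hsn : ‖s‖ = 1 := by
      have : ‖s‖ ^ 2 = 1 := by rw [← norm_pow, hs, htn]
      nlinarith [norm_nonneg s]
    have hs0 : s ≠ 0 := by rintro rfl; simp at hsn
    have hsc : s * starRingEnd ℂ s = 1 := by rw [Complex.mul_conj, Complex.normSq_eq_norm_sq, hsn]; simp
    have hsc0 : starRingEnd ℂ s ≠ 0 := by simpa using hs0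
    have hq : s / starRingEnd ℂ s = t := by
      rw [div_eq_iff hsc0, ← hs]; linear_combination -s * hsc
    have h1 := eval_eq_conj_pow_mul_eval_dehom hw hs0
    rw [hq] at h1
    have h2 := congrArg (starRingEnd ℂ) h1
    rw [Complex.conj_ofReal, map_mul, map_pow, Complex.conj_conj, h1] at h2
    have h3 : starRingEnd ℂ (eval t p) = eval (t⁻¹) (p.map (starRingEnd ℂ)) := by
      have : t⁻¹ = starRingEnd ℂ t := by
        rw [Complex.inv_def, Complex.normSq_eq_norm_sq, htn]; simp
      rw [this, eval_map, eval₂_hom]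
    let _ : Invertible t⁻¹ := invertibleOfNonzero (inv_ne_zero ht0)
    have h4 := eval₂_reflect_mul_pow (RingHom.id ℂ) t⁻¹ n (p.map (starRingEnd ℂ))
      ((natDegree_map_le).trans (natDegree_dehom_le hw))
    rw [invOf_eq_inv, inv_inv, ← eval, ← eval, ← h3] at h4
    have h5 : eval t (reflect n (p.map (starRingEnd ℂ))) = t ^ n * starRingEnd ℂ (eval t p) := by
      rw [← h4, mul_comm (t ^ n), mul_assoc, ← mul_pow, inv_mul_cancel₀ ht0, one_pow, mul_one]
    have h6 : s ^ n * starRingEnd ℂ s ^ n = 1 := by rw [← mul_pow, hsc, one_pow]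
    change eval t p = _
    rw [h5, ← hs, ← pow_mul, two_mul, pow_add, hs]
    linear_combination s ^ n * h2 - eval t p * h6
  have hi := congrArg (fun q => q.coeff i) key
  simp only [coeff_reflect, coeff_map] at hi
  rw [hi, revAt_le (by omega), show n - i = j by omega]

end Dehomogenisation

/-! ### Classification of the leading forms, and the angular derivative. -/

section Classification

open Polynomial
open MvPolynomial (pderiv)

theorem pderiv_comm (i j : Fin 2) (w : MvPolynomial (Fin 2) ℝ) :
    pderiv i (pderiv j w) = pderiv j (pderiv i w) := by
  induction w using MvPolynomial.induction_on with
  | C a => simp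
  | add p q hp hq => simp only [map_add, hp, hq]
  | mul_X p l hp =>
    have h : ∀ a b c : Fin 2, pderiv a (pderiv b (MvPolynomial.X c : MvPolynomial (Fin 2) ℝ)) = 0 := by
      intro a b c
      rw [MvPolynomial.pderiv_X]
      by_cases hb : c = b
      · subst hb; simp
      · simp [Ne.symm hb]
    simp only [Derivation.leibniz, map_add, smul_eq_mul, hp, h]
    ring

/-- The Laplacian of a polynomial. -/
noncomputable def polyLap (w : MvPolynomial (Fin 2) ℝ) : MvPolynomial (Fin 2) ℝ :=
  pderiv 0 (pderiv 0 w) + pderiv 1 (pderiv 1 w)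

/-- The polarised Hessian determinant of two polynomials. -/
noncomputable def polyMixedHess (v w : MvPolynomial (Fin 2) ℝ) : MvPolynomial (Fin 2) ℝ :=
  pderiv 0 (pderiv 0 v) * pderiv 1 (pderiv 1 w) + pderiv 1 (pderiv 1 v) * pderiv 0 (pderiv 0 w)
    - 2 * (pderiv 1 (pderiv 0 v) * pderiv 1 (pderiv 0 w))

/-- The Hessian determinant of a polynomial. -/
noncomputable def polyHess (w : MvPolynomial (Fin 2) ℝ) : MvPolynomial (Fin 2) ℝ :=
  pderiv 0 (pderiv 0 w) * pderiv 1 (pderiv 1 w) - pderiv 1 (pderiv 0 w) ^ 2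

/-- The Jacobian of two polynomials. -/
noncomputable def polyJac (f g : MvPolynomial (Fin 2) ℝ) : MvPolynomial (Fin 2) ℝ :=
  pderiv 0 f * pderiv 1 g - pderiv 1 f * pderiv 0 g

theorem polyLap_isHomogeneous {w : MvPolynomial (Fin 2) ℝ} {n : ℕ} (hw : w.IsHomogeneous n) :
    (polyLap w).IsHomogeneous (n - 2) :=
  (hw.pderiv.pderiv).add (hw.pderiv.pderiv)

theorem polyHess_isHomogeneous {w : MvPolynomial (Fin 2) ℝ} {n : ℕ} (hw : w.IsHomogeneous n) :
    (polyHess w).IsHomogeneous (2 * (n - 2)) := by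
  have h := hw.pderiv (i := 0) |>.pderiv (i := 1) |>.pow 2
  have h2 := (hw.pderiv (i := 0) |>.pderiv (i := 0)).mul (hw.pderiv (i := 1) |>.pderiv (i := 1))
  rw [Nat.sub_sub, mul_comm] at h
  rw [Nat.sub_sub, ← two_mul] at h2
  exact h2.sub h

theorem C_I_sq : (C Complex.I : ℂ[X]) ^ 2 = -1 := by
  rw [← C_pow, Complex.I_sq, C_neg, C_1]

theorem C_half : (C (1 / 2) : ℂ[X]) * 2 = 1 := by
  rw [show (2 : ℂ[X]) = C 2 from rfl, ← C_mul, ← C_1]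
  norm_num

theorem C_neg_I_half : (C (-Complex.I / 2) : ℂ[X]) = - (C Complex.I * C (1 / 2)) := by
  rw [← C_mul, ← C_neg]
  congr 1; ring

theorem euler_dehom {w : MvPolynomial (Fin 2) ℝ} {n : ℕ} (hw : w.IsHomogeneous n) :
    C (1 / 2) * (X + 1) * dehom (pderiv 0 w)
      - C Complex.I * C (1 / 2) * (X - 1) * dehom (pderiv 1 w) = C (n : ℂ) * dehom w := by
  have h := congrArg dehom (euler hw)
  simp only [map_add, map_mul, dehom_X_zero, dehom_X_one, map_natCast, C_neg_I_half] at h ⊢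
  linear_combination h

theorem derivative_dehom' (w : MvPolynomial (Fin 2) ℝ) :
    derivative (dehom w) = C (1 / 2) * dehom (pderiv 0 w)
      - C Complex.I * C (1 / 2) * dehom (pderiv 1 w) := by
  rw [derivative_dehom, C_neg_I_half]; ring

theorem derivative_derivative_dehom (w : MvPolynomial (Fin 2) ℝ) :
    derivative (derivative (dehom w)) = C (1 / 2) ^ 2 * (dehom (pderiv 0 (pderiv 0 w))
      - dehom (pderiv 1 (pderiv 1 w)))
      - 2 * C Complex.I * C (1 / 2) ^ 2 * dehom (pderiv 1 (pderiv 0 w)) := by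
  rw [derivative_dehom', derivative_sub, mul_assoc, derivative_C_mul, derivative_C_mul,
    derivative_C_mul, derivative_dehom', derivative_dehom', pderiv_comm 0 1 w]
  linear_combination (C (1 / 2) ^ 2 * dehom (pderiv 1 (pderiv 1 w))) * C_I_sq

/-- The derivative in `z̄` is lost on setting `z̄ = 1`; Euler's relation for `w_x` and `w_y`
recovers it, giving `w_zz̄ = Δw / 4`. -/
theorem mixedPart_dehom {w : MvPolynomial (Fin 2) ℝ} {k : ℕ} (hk : 1 ≤ k) (hw : w.IsHomogeneous k) :
    mixedPart k (dehom w) = C (1 / 2) ^ 2 * dehom (polyLap w) := by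
  have e0 := euler_dehom (hw.pderiv (i := 0))
  have e1 := euler_dehom (hw.pderiv (i := 1))
  rw [Nat.cast_sub hk, Nat.cast_one] at e0 e1
  rw [pderiv_comm 0 1] at e1
  rw [mixedPart, derivative_derivative_dehom, derivative_dehom', polyLap, map_add]
  linear_combination -C (1 / 2) * e0 + C Complex.I * C (1 / 2) * e1
    + C (1 / 2) ^ 2 * dehom (pderiv 1 (pderiv 1 w)) * (X - 1) * C_I_sq

theorem conjPart_dehom {w : MvPolynomial (Fin 2) ℝ} {k : ℕ} (hk : 1 ≤ k) (hw : w.IsHomogeneous k) :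
    conjPart k (dehom w) = C (1 / 2) ^ 2 * (dehom (pderiv 0 (pderiv 0 w))
      - dehom (pderiv 1 (pderiv 1 w)))
      + 2 * C Complex.I * C (1 / 2) ^ 2 * dehom (pderiv 1 (pderiv 0 w)) := by
  have e := euler_dehom hw
  have e0 := euler_dehom (hw.pderiv (i := 0))
  have e1 := euler_dehom (hw.pderiv (i := 1))
  rw [Nat.cast_sub hk, Nat.cast_one] at e0 e1
  rw [pderiv_comm 0 1] at e1
  have h2 : (C (2 : ℂ) : ℂ[X]) = 2 := rfl
  rw [conjPart, derivative_derivative_dehom, derivative_dehom', C_mul, C_mul, h2]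
  linear_combination (-C ((k : ℂ) - 1)) * e - C (1 / 2) * (1 - X) * e0
    - C Complex.I * C (1 / 2) * (X + 1) * e1
    - C (1 / 2) ^ 2 * (X ^ 2 - 1) * dehom (pderiv 1 (pderiv 1 w)) * C_I_sq

theorem dehom_polyHess {w : MvPolynomial (Fin 2) ℝ} {k : ℕ} (hk : 1 ≤ k) (hw : w.IsHomogeneous k) :
    dehom (polyHess w) = 4 * (mixedPart k (dehom w) ^ 2
      - derivative (derivative (dehom w)) * conjPart k (dehom w)) := by
  rw [mixedPart_dehom hk hw, conjPart_dehom hk hw, derivative_derivative_dehom, polyHess, polyLap]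
  simp only [map_sub, map_mul, map_pow, map_add]
  have h4 : (C (1 / 2) : ℂ[X]) ^ 4 * 16 = 1 := by
    have := congrArg (· ^ 4) C_half
    simp only [mul_pow, one_pow] at this
    rw [← this]; norm_num
  generalize dehom (pderiv 0 (pderiv 0 w)) = A
  generalize dehom (pderiv 1 (pderiv 1 w)) = B
  generalize dehom (pderiv 1 (pderiv 0 w)) = D
  linear_combination -(A * B - D ^ 2) * h4 - 16 * C (1 / 2) ^ 4 * D ^ 2 * C_I_sq

/-- Parallel gradients combined with Euler's relations for degrees `n` and `2n` say that the
differential of `G / F²` vanishes. -/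
theorem jac_quasi_const {F G : MvPolynomial (Fin 2) ℝ} {n : ℕ} (hn : 1 ≤ n)
    (hF : F.IsHomogeneous n) (hG : G.IsHomogeneous (2 * n)) (h : polyJac F G = 0) (i : Fin 2) :
    2 * G * pderiv i F = F * pderiv i G := by
  have eF := euler hF
  have eG := euler hG
  rw [polyJac] at h
  have hn0 : (n : MvPolynomial (Fin 2) ℝ) ≠ 0 := by
    norm_cast; omega
  apply mul_left_cancel₀ hn0
  push_cast at eG
  fin_cases i
  · simp only [Fin.zero_eta]
    linear_combination (-pderiv 0 F) * eG + pderiv 0 G * eF + MvPolynomial.X 1 * h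
  · simp only [Fin.mk_one]
    linear_combination (-pderiv 1 F) * eG + pderiv 1 G * eF - MvPolynomial.X 0 * h

/-- By reality the extreme coefficients have equal modulus, so `|t| = 1`, and then `z - t z̄` is a
complex multiple of a real linear form. -/
theorem isMultipleOfLinearPower_of_dehom {w : MvPolynomial (Fin 2) ℝ} {k : ℕ} (hk : 1 ≤ k)
    (hw : w.IsHomogeneous k) {a t : ℂ} (ha : a ≠ 0) (h : dehom w = C a * (X - C t) ^ k) :
    IsMultipleOfLinearPower w k := by
  have hk' : (dehom w).coeff k = a := by
    have hm : ((X - C t) ^ k).Monic := (monic_X_sub_C t).pow k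
    have hd : ((X - C t) ^ k).natDegree = k := by rw [natDegree_pow, natDegree_X_sub_C, mul_one]
    have := hm.coeff_natDegree
    rw [hd] at this
    rw [h, coeff_C_mul, this, mul_one]
  have h0 : (dehom w).coeff 0 = a * (-t) ^ k := by
    rw [h, coeff_zero_eq_eval_zero]; simp
  have hn := congrArg norm (coeff_dehom_conj hw (show k + 0 = k by omega))
  rw [hk', h0, RCLike.norm_conj, norm_mul, norm_pow, norm_neg] at hn
  have ht : ‖t‖ = 1 := by
    have h1 : ‖t‖ ^ k = 1 := by
      have : ‖a‖ ≠ 0 := norm_ne_zero_iff.2 ha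
      apply mul_left_cancel₀ this
      rw [mul_one, ← hn]
    exact (pow_eq_one_iff_of_nonneg (norm_nonneg _) (by omega)).1 h1
  obtain ⟨s, hs⟩ := IsAlgClosed.exists_pow_nat_eq t (n := 2) (by norm_num)
  have hsn : ‖s‖ = 1 := by
    have : ‖s‖ ^ 2 = 1 := by rw [← norm_pow, hs, ht]
    nlinarith [norm_nonneg s]
  have hs0 : s ≠ 0 := by rintro rfl; simp at hsn
  have hsc : s * starRingEnd ℂ s = 1 := by
    rw [Complex.mul_conj, Complex.normSq_eq_norm_sq, hsn]; simp
  -- With `s² = t`, this is `Im (s̄ z) = μ (z - t z̄)`, the real form vanishing in the direction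
  -- `s`.
  set L : MvPolynomial (Fin 2) ℝ := MvPolynomial.C (-s.im) * MvPolynomial.X 0
    + MvPolynomial.C s.re * MvPolynomial.X 1 with hL
  set μ : ℂ := -Complex.I * starRingEnd ℂ s / 2 with hμ
  have hμ0 : μ ≠ 0 := by simp [hμ, hs0]
  have hre : starRingEnd ℂ s = s.re - s.im * Complex.I := by apply Complex.ext <;> simp
  have hsre : s = s.re + s.im * Complex.I := (Complex.re_add_im s).symm
  have hdL : dehom L = C μ * (X - C t) := by
    have e1 : μ = (-(s.im : ℂ) * (1 / 2) + (s.re : ℂ) * (-Complex.I / 2)) := by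
      rw [hμ, hre]; linear_combination (s.im / 2 : ℂ) * Complex.I_sq
    have e2 : μ * t = (s.im : ℂ) * (1 / 2) + (s.re : ℂ) * (-Complex.I / 2) := by
      have : μ * t = -Complex.I * s / 2 := by
        rw [hμ, ← hs]; linear_combination (-Complex.I * s / 2) * hsc
      rw [this]; nth_rewrite 1 [hsre]
      linear_combination (-s.im / 2 : ℂ) * Complex.I_sq
    rw [mul_sub, ← C_mul, e2, e1, hL]
    simp only [map_add, map_mul, dehom_C, dehom_X_zero, dehom_X_one, C_neg,
      Complex.ofReal_neg]
    ring
  have hhL : L.IsHomogeneous 1 :=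
    (MvPolynomial.isHomogeneous_C_mul_X _ _).add (MvPolynomial.isHomogeneous_C_mul_X _ _)
  have hhLk : (L ^ k).IsHomogeneous k := by simpa using hhL.pow k
  have hfin := eq_C_re_mul_of_dehom_eq hw hhLk (c := a / μ ^ k) (by
    rw [map_pow, hdL, h, mul_pow, ← mul_assoc, ← C_pow, ← C_mul, div_mul_cancel₀ _ (pow_ne_zero _ hμ0)])
  refine ⟨_, _, _, ?_, hfin⟩
  intro h
  rw [Prod.mk.injEq] at h
  apply hs0
  apply Complex.ext
  · exact h.2
  · simpa using h.1

theorem dehom_sq_add_sq :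
    dehom (MvPolynomial.X 0 ^ 2 + MvPolynomial.X 1 ^ 2) = X := by
  simp only [map_add, map_pow, dehom_X_zero, dehom_X_one, C_neg_I_half]
  linear_combination C (1 / 2) ^ 2 * (X - 1) ^ 2 * C_I_sq + X * (2 * C (1 / 2) + 1) * C_half

theorem isHomogeneous_sq_add_sq_pow (j : ℕ) :
    ((MvPolynomial.X 0 ^ 2 + MvPolynomial.X 1 ^ 2 : MvPolynomial (Fin 2) ℝ) ^ j).IsHomogeneous
      (2 * j) :=
  ((MvPolynomial.isHomogeneous_X_pow _ _).add (MvPolynomial.isHomogeneous_X_pow _ _)).pow j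

/-- A form of degree `k ≥ 3` with `J[Δw, H(w)] = 0` is harmonic, a power of a linear form, or a
multiple of a power of `x² + y²`. -/
theorem exists_eq_C_mul_sq_add_sq_pow {w : MvPolynomial (Fin 2) ℝ} {k : ℕ} (hk : 3 ≤ k)
    (hw : w.IsHomogeneous k) (hJ : polyJac (polyLap w) (polyHess w) = 0) (hlap : polyLap w ≠ 0)
    (hlin : ¬ IsMultipleOfLinearPower w k) :
    ∃ (a : ℝ) (j : ℕ), 2 * j = k ∧
      w = MvPolynomial.C a * (MvPolynomial.X 0 ^ 2 + MvPolynomial.X 1 ^ 2) ^ j := by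
  have hq := jac_quasi_const (by omega) (polyLap_isHomogeneous hw) (polyHess_isHomogeneous hw) hJ
  have hf : dehom (polyLap w) ≠ 0 := fun h =>
    hlap (eq_zero_of_dehom_eq_zero (polyLap_isHomogeneous hw) h)
  obtain ⟨c, hc⟩ := exists_eq_C_mul_sq_of_derivative (g := dehom (polyHess w)) hf (by
    have h0 := congrArg dehom (hq 0)
    have h1 := congrArg dehom (hq 1)
    simp only [map_mul, map_ofNat] at h0 h1
    rw [derivative_dehom', derivative_dehom']
    linear_combination C (1 / 2) * h0 - C Complex.I * C (1 / 2) * h1)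
  have hk1 : 1 ≤ k := by omega
  have hS := mixedPart_dehom hk1 hw
  have hS0 : mixedPart k (dehom w) ≠ 0 := by
    rw [hS]
    exact mul_ne_zero (pow_ne_zero _ (by norm_num)) hf
  have hlapS : dehom (polyLap w) = 4 * mixedPart k (dehom w) := by
    rw [hS]; linear_combination (-dehom (polyLap w) * (2 * C (1 / 2) + 1)) * C_half
  rw [dehom_polyHess hk1 hw, hlapS] at hc
  have hmain : derivative (derivative (dehom w)) * conjPart k (dehom w)
      = C (1 - 4 * c) * mixedPart k (dehom w) ^ 2 := by
    have h4 : (4 : ℂ[X]) ≠ 0 := by norm_num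
    apply mul_left_cancel₀ h4
    rw [C_sub, C_mul, C_1, show (C (4 : ℂ) : ℂ[X]) = 4 from rfl]
    linear_combination -hc
  -- This is the case `c = 0`, that is `H(w) = 0`.
  by_cases hc1 : 1 - 4 * c = 1
  · exfalso
    rw [hc1, C_1, one_mul] at hmain
    have h5 := mixedPart_sq_sub k (dehom w)
    rw [hmain, sub_self] at h5
    have hkC : (C ((k : ℂ) - 1) : ℂ[X]) ≠ 0 := by
      rw [Ne, C_eq_zero, sub_eq_zero]; norm_cast; omega
    have h6 : C (k : ℂ) * (dehom w * derivative (derivative (dehom w)))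
        = C ((k : ℂ) - 1) * derivative (dehom w) ^ 2 := by
      apply mul_left_cancel₀ hkC
      rw [C_mul, C_pow] at h5
      linear_combination h5
    have hp : derivative (dehom w) ≠ 0 := by
      intro h0; apply hS0; rw [mixedPart, h0]; simp
    obtain ⟨a, t, hat⟩ := eq_C_mul_X_sub_C_pow hp (natDegree_dehom_le hw) h6
    refine hlin (isMultipleOfLinearPower_of_dehom hk1 hw (a := a) ?_ hat)
    rintro rfl
    rw [hat] at hp
    simp at hp
  · obtain ⟨a, j, hj, ha⟩ := eq_C_mul_X_pow_of_conj_symm hk hc1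
      (fun i j hij => coeff_dehom_conj hw hij) (natDegree_dehom_le hw) hS0 hmain
    refine ⟨a.re, j, hj, ?_⟩
    apply eq_C_re_mul_of_dehom_eq hw (hj ▸ isHomogeneous_sq_add_sq_pow j)
    rw [map_pow, dehom_sq_add_sq, ha]

/-- The angular derivative `x ∂_y - y ∂_x`. -/
noncomputable def polyRot (w : MvPolynomial (Fin 2) ℝ) : MvPolynomial (Fin 2) ℝ :=
  MvPolynomial.X 0 * pderiv 1 w - MvPolynomial.X 1 * pderiv 0 w

theorem polyRot_isHomogeneous {w : MvPolynomial (Fin 2) ℝ} {n : ℕ} (hw : w.IsHomogeneous n) :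
    (polyRot w).IsHomogeneous n := by
  rcases Nat.eq_zero_or_pos n with rfl | hn
  · rw [← MvPolynomial.totalDegree_zero_iff_isHomogeneous,
      MvPolynomial.totalDegree_eq_zero_iff_eq_C] at hw
    rw [polyRot, hw]
    simpa using MvPolynomial.isHomogeneous_zero _ _ _
  have h1 := (MvPolynomial.isHomogeneous_X ℝ (0 : Fin 2)).mul (hw.pderiv (i := 1))
  have h2 := (MvPolynomial.isHomogeneous_X ℝ (1 : Fin 2)).mul (hw.pderiv (i := 0))
  rw [show 1 + (n - 1) = n by omega] at h1 h2
  exact h1.sub h2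

/-- In complex coordinates `∂_θ = i (z ∂_z - z̄ ∂_z̄)`, and Euler replaces `z̄ ∂_z̄` by `n - z ∂_z`.
Thus `X ^ l` is an eigenvector with eigenvalue `i (2l - n)`. -/
theorem dehom_polyRot {w : MvPolynomial (Fin 2) ℝ} {n : ℕ} (hw : w.IsHomogeneous n) :
    dehom (polyRot w) = C Complex.I * (2 * (X * derivative (dehom w)) - C (n : ℂ) * dehom w) := by
  rw [← euler_dehom hw, derivative_dehom', polyRot]
  simp only [map_sub, map_mul, dehom_X_zero, dehom_X_one, C_neg_I_half]
  linear_combination C (1 / 2) * (X + 1) * dehom (pderiv 1 w) * C_I_sq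

/-- The operator `(x ∂_y - y ∂_x)²` has no positive eigenvalues on forms. -/
theorem eq_zero_of_polyRot_polyRot_eq {w : MvPolynomial (Fin 2) ℝ} {n : ℕ}
    (hw : w.IsHomogeneous n) {κ : ℝ} (hκ : 0 < κ)
    (h : polyRot (polyRot w) = MvPolynomial.C κ * w) : w = 0 := by
  apply eq_zero_of_dehom_eq_zero hw
  have hc : ∀ (q : ℂ[X]) (l : ℕ), (X * derivative q).coeff l = l * q.coeff l := by
    intro q l
    cases l with
    | zero => simp
    | succ n => rw [coeff_X_mul, coeff_derivative]; push_cast; ring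
  have h1 : ∀ {v : MvPolynomial (Fin 2) ℝ}, v.IsHomogeneous n → ∀ l,
      (dehom (polyRot v)).coeff l = Complex.I * ((2 * l - n) * (dehom v).coeff l) := by
    intro v hv l
    rw [dehom_polyRot hv, coeff_C_mul, coeff_sub, coeff_C_mul, show (2 : ℂ[X]) = C 2 from rfl,
      coeff_C_mul, hc]
    ring
  ext l
  have h2 := congrArg (fun q => (dehom q).coeff l) h
  simp only [map_mul, dehom_C, coeff_C_mul, h1 (polyRot_isHomogeneous hw), h1 hw] at h2
  have h3 : ((κ + (2 * l - n) ^ 2 : ℝ) : ℂ) * (dehom w).coeff l = 0 := by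
    push_cast
    linear_combination -h2 + (2 * (l : ℂ) - n) ^ 2 * (dehom w).coeff l * Complex.I_sq
  rw [coeff_zero]
  refine (mul_eq_zero.1 h3).resolve_left ?_
  have : 0 < κ + (2 * l - n : ℝ) ^ 2 := by positivity
  exact_mod_cast this.ne'

end Classification

/-! ### Linearisation of the equation at a power of `x² + y²`. -/

section Perturbation

open MvPolynomial

/-- Real polynomials in two variables. -/
abbrev Poly : Type := MvPolynomial (Fin 2) ℝ

/-- The polynomial `x² + y²`. -/
noncomputable def sqNorm : Poly := (X 0 : Poly) ^ 2 + (X 1 : Poly) ^ 2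

theorem pderiv_zero_sqNorm : pderiv 0 sqNorm = 2 * X 0 := by
  simp [sqNorm, pderiv_X]

theorem pderiv_one_sqNorm : pderiv 1 sqNorm = 2 * X 1 := by
  simp [sqNorm, pderiv_X]

theorem pderiv_zero_sqNorm_pow (l : ℕ) :
    pderiv 0 (sqNorm ^ (l + 1)) = 2 * ((l : Poly) + 1) * (X 0 : Poly) * sqNorm ^ l := by
  rw [pderiv_pow, pderiv_zero_sqNorm]; push_cast; ring

theorem pderiv_one_sqNorm_pow (l : ℕ) :
    pderiv 1 (sqNorm ^ (l + 1)) = 2 * ((l : Poly) + 1) * (X 1 : Poly) * sqNorm ^ l := by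
  rw [pderiv_pow, pderiv_one_sqNorm]; push_cast; ring

theorem pderiv_natCast_mul (i : Fin 2) (a : ℕ) (f : Poly) :
    pderiv i ((a : Poly) * f) = a * pderiv i f := by
  rw [pderiv_mul]; simp

theorem pderiv_zero_zero_sqNorm_pow (i : ℕ) :
    pderiv 0 (pderiv 0 (sqNorm ^ (i + 2)))
      = 2 * ((i : Poly) + 2) * sqNorm ^ i * (sqNorm + 2 * ((i : Poly) + 1) * (X 0 : Poly) ^ 2) := by
  rw [pderiv_zero_sqNorm_pow, show (2 * (((i + 1 : ℕ) : Poly) + 1) * (X 0 : Poly) * sqNorm ^ (i + 1) :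
    Poly) = ((2 * (i + 2) : ℕ) : Poly)
      * (X 0 * sqNorm ^ (i + 1)) by push_cast; ring, pderiv_natCast_mul, pderiv_mul,
    pderiv_zero_sqNorm_pow, pderiv_X_self]
  push_cast; ring

theorem pderiv_one_one_sqNorm_pow (i : ℕ) :
    pderiv 1 (pderiv 1 (sqNorm ^ (i + 2)))
      = 2 * ((i : Poly) + 2) * sqNorm ^ i * (sqNorm + 2 * ((i : Poly) + 1) * (X 1 : Poly) ^ 2) := by
  rw [pderiv_one_sqNorm_pow, show (2 * (((i + 1 : ℕ) : Poly) + 1) * (X 1 : Poly) * sqNorm ^ (i + 1) :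
    Poly) = ((2 * (i + 2) : ℕ) : Poly)
      * (X 1 * sqNorm ^ (i + 1)) by push_cast; ring, pderiv_natCast_mul, pderiv_mul,
    pderiv_one_sqNorm_pow, pderiv_X_self]
  push_cast; ring

theorem pderiv_one_zero_sqNorm_pow (i : ℕ) :
    pderiv 1 (pderiv 0 (sqNorm ^ (i + 2)))
      = 4 * ((i : Poly) + 2) * ((i : Poly) + 1) * sqNorm ^ i * (X 0 : Poly) * X 1 := by
  rw [pderiv_zero_sqNorm_pow, show (2 * (((i + 1 : ℕ) : Poly) + 1) * (X 0 : Poly) * sqNorm ^ (i + 1) :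
    Poly) = ((2 * (i + 2) : ℕ) : Poly)
      * (X 0 * sqNorm ^ (i + 1)) by push_cast; ring, pderiv_natCast_mul, pderiv_mul,
    pderiv_one_sqNorm_pow, pderiv_X_of_ne (by decide)]
  push_cast; ring

theorem polyLap_sqNorm_pow (i : ℕ) :
    polyLap (sqNorm ^ (i + 2)) = ((4 * (i + 2) ^ 2 : ℕ) : Poly) * sqNorm ^ (i + 1) := by
  rw [polyLap, pderiv_zero_zero_sqNorm_pow, pderiv_one_one_sqNorm_pow, pow_succ sqNorm i]
  push_cast; rw [sqNorm]; ring

theorem polyHess_sqNorm_pow (i : ℕ) :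
    polyHess (sqNorm ^ (i + 2))
      = ((4 * (i + 2) ^ 2 * (2 * i + 3) : ℕ) : Poly) * sqNorm ^ (2 * i + 1 + 1) := by
  rw [polyHess, pderiv_zero_zero_sqNorm_pow, pderiv_one_one_sqNorm_pow, pderiv_one_zero_sqNorm_pow,
    show 2 * i + 1 + 1 = i + i + 2 by ring, pow_add, pow_add]
  push_cast
  generalize sqNorm ^ i = t
  rw [sqNorm]; ring

theorem polyRot_add (f g : Poly) : polyRot (f + g) = polyRot f + polyRot g := by
  simp only [polyRot, map_add]; ring

theorem polyRot_mul (f g : Poly) :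
    polyRot (f * g) = f * polyRot g + polyRot f * g := by
  simp only [polyRot, pderiv_mul]; ring

theorem polyRot_sqNorm : polyRot sqNorm = 0 := by
  rw [polyRot, pderiv_one_sqNorm, pderiv_zero_sqNorm]; ring

theorem polyRot_sqNorm_pow (i : ℕ) : polyRot (sqNorm ^ i) = 0 := by
  induction i with
  | zero => simp [polyRot]
  | succ i ih => rw [pow_succ, polyRot_mul, ih, polyRot_sqNorm]; ring

theorem polyRot_natCast (i : ℕ) : polyRot (i : Poly) = 0 := by
  simp [polyRot]

theorem polyRot_natCast_mul (i : ℕ) (f : Poly) :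
    polyRot ((i : Poly) * f) = i * polyRot f := by
  rw [polyRot_mul, polyRot_natCast]; ring

theorem polyRot_polyRot {q : Poly} {n : ℕ} (hq : q.IsHomogeneous n) :
    polyRot (polyRot q) = (X 0 : Poly) ^ 2 * pderiv 1 (pderiv 1 q) + (X 1 : Poly) ^ 2 * pderiv 0 (pderiv 0 q)
      - 2 * (X 0 : Poly) * (X 1 : Poly) * pderiv 1 (pderiv 0 q) - (n : Poly) * q := by
  have h10 : pderiv 1 (X 0 : Poly) = 0 := pderiv_X_of_ne (by decide)
  have h01 : pderiv 0 (X 1 : Poly) = 0 := pderiv_X_of_ne (by decide)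
  rw [← euler hq, polyRot, polyRot]
  simp only [map_sub, pderiv_mul, h10, h01, pderiv_X_self, pderiv_comm 0 1 q]
  ring

/-- Polar form `ϱ² Δ = ∂_θ² + (ϱ ∂_ϱ)²`, where `ϱ ∂_ϱ` acts as `n` on forms. -/
theorem sqNorm_mul_polyLap {q : Poly} {n : ℕ} (hq : q.IsHomogeneous n) :
    sqNorm * polyLap q = polyRot (polyRot q) + (n : Poly) ^ 2 * q := by
  have h10 : pderiv 1 (X 0 : Poly) = 0 := pderiv_X_of_ne (by decide)
  have h01 : pderiv 0 (X 1 : Poly) = 0 := pderiv_X_of_ne (by decide)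
  have e := euler hq
  have e0 := congrArg (pderiv 0) e
  have e1 := congrArg (pderiv 1) e
  rw [pderiv_natCast_mul] at e0 e1
  simp only [map_add, pderiv_mul, h10, h01, pderiv_X_self, pderiv_comm 0 1 q] at e0 e1
  rw [polyRot_polyRot hq, polyLap, sqNorm]
  linear_combination (X 0 : Poly) * e0 + (X 1 : Poly) * e1 + ((n : Poly) - 1) * e

/-- For radial `f` the polarised Hessian is `f'' (q_ϱ / ϱ + q_θθ / ϱ²) + (f' / ϱ) q_ϱϱ`, here with
`f = ϱ^(2i + 4)`. -/
theorem polyMixedHess_sqNorm_pow {q : Poly} {n : ℕ} (hq : q.IsHomogeneous n)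
    (i : ℕ) :
    polyMixedHess (sqNorm ^ (i + 2)) q = ((2 * (i + 2) : ℕ) : Poly) *
      (sqNorm ^ i * (((2 * i + 3 : ℕ) : Poly) * polyRot (polyRot q)
        + ((n * (n + 2 * i + 2) : ℕ) : Poly) * q)) := by
  have h1 := sqNorm_mul_polyLap hq
  have h2 := polyRot_polyRot hq
  rw [polyLap] at h1
  rw [polyMixedHess, pderiv_zero_zero_sqNorm_pow, pderiv_one_one_sqNorm_pow,
    pderiv_one_zero_sqNorm_pow]
  push_cast
  linear_combination 2 * ((i : Poly) + 2) * sqNorm ^ i * h1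
    - 4 * ((i : Poly) + 2) * (i + 1) * sqNorm ^ i * h2

theorem polyJac_natCast_mul_sqNorm_pow (a l : ℕ) (f : Poly) :
    polyJac ((a : Poly) * sqNorm ^ (l + 1)) f
      = a * (2 * ((l : Poly) + 1)) * sqNorm ^ l * polyRot f := by
  rw [polyJac, pderiv_natCast_mul, pderiv_natCast_mul, pderiv_zero_sqNorm_pow,
    pderiv_one_sqNorm_pow, polyRot]
  ring

theorem polyJac_swap (f g : Poly) : polyJac f g = - polyJac g f := by
  rw [polyJac, polyJac]; ring

/-- A Jacobian against a radial function is a radial multiple of `∂_θ`, so both terms become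
polynomials in `∂_θ` applied to `q`. -/
theorem linearised_jacobian {q : Poly} {n : ℕ} (hq : q.IsHomogeneous n)
    (i : ℕ) :
    polyJac (polyLap (sqNorm ^ (i + 2))) (polyMixedHess (sqNorm ^ (i + 2)) q)
      + polyJac (polyLap q) (polyHess (sqNorm ^ (i + 2)))
      = 16 * ((i : Poly) + 2) ^ 2 * ((i : Poly) + 1) ^ 2 * sqNorm ^ (2 * i) * ((2 * (i : Poly) + 3) * polyRot (polyRot (polyRot q))
        - (n : Poly) * ((n : Poly) - (2 * (i : Poly) + 4)) * polyRot q) := by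
  have h1 := congrArg polyRot (sqNorm_mul_polyLap hq)
  rw [polyRot_mul, polyRot_sqNorm, polyRot_add, ← Nat.cast_pow, polyRot_natCast_mul] at h1
  rw [polyLap_sqNorm_pow, polyJac_natCast_mul_sqNorm_pow, polyJac_swap (polyLap q),
    polyHess_sqNorm_pow, polyJac_natCast_mul_sqNorm_pow, polyMixedHess_sqNorm_pow hq,
    polyRot_natCast_mul, polyRot_mul, polyRot_sqNorm_pow, polyRot_add, polyRot_natCast_mul,
    polyRot_natCast_mul, pow_succ, two_mul i, pow_add]
  push_cast at h1 ⊢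
  linear_combination (-16 * ((i : Poly) + 2) ^ 2 * (2 * i + 3) * (i + 1)
    * sqNorm ^ i * sqNorm ^ i) * h1

/-- A form of degree `n > 2 i + 4` in the kernel of the linearisation at `(x² + y²)^(i + 2)` is
radial. -/
theorem polyRot_eq_zero_of_linearised {q : Poly} {n i : ℕ}
    (hq : q.IsHomogeneous n) (hn : 2 * i + 4 < n)
    (h : polyJac (polyLap (sqNorm ^ (i + 2))) (polyMixedHess (sqNorm ^ (i + 2)) q)
      + polyJac (polyLap q) (polyHess (sqNorm ^ (i + 2))) = 0) : polyRot q = 0 := by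
  rw [linearised_jacobian hq] at h
  have hs : sqNorm ≠ 0 := by
    intro h0
    have := congrArg dehom h0
    rw [sqNorm, dehom_sq_add_sq, map_zero] at this
    exact Polynomial.X_ne_zero this
  have h1 : (16 * ((i : Poly) + 2) ^ 2 * ((i : Poly) + 1) ^ 2 * sqNorm ^ (2 * i) : Poly) ≠ 0 := by
    have : (16 * ((i : Poly) + 2) ^ 2 * ((i : Poly) + 1) ^ 2 : Poly) ≠ 0 := by
      norm_cast
      positivity
    exact mul_ne_zero this (pow_ne_zero _ hs)
  have h2 := (mul_eq_zero.1 h).resolve_left h1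
  have hpos : (0 : ℝ) < 2 * i + 3 := by positivity
  -- The equation says that `∂_θ q` is an eigenvector of `∂_θ²` with this eigenvalue, positive
  -- because `n > 2i + 4`.
  refine eq_zero_of_polyRot_polyRot_eq (polyRot_isHomogeneous hq)
    (κ := n * (n - (2 * i + 4)) / (2 * i + 3)) ?_ ?_
  · have : (2 * i + 4 : ℝ) < n := by exact_mod_cast hn
    have h3 : (0 : ℝ) < n := by linarith [(Nat.cast_nonneg i : (0 : ℝ) ≤ i)]
    have h4 : (0 : ℝ) < n - (2 * i + 4) := by linarith
    positivity
  · have h3 : (C (2 * i + 3 : ℝ) : Poly) ≠ 0 := by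
      rw [Ne, C_eq_zero]; exact hpos.ne'
    apply mul_left_cancel₀ h3
    rw [← mul_assoc, ← C_mul, mul_div_cancel₀ _ hpos.ne']
    simp only [C_mul, C_add, C_sub, map_natCast, map_ofNat]
    linear_combination h2

end Perturbation

/-! ### Partial derivatives, order of vanishing and leading forms at the origin. -/

section VanishingOrder

/-! ### Partial derivatives -/

theorem partialD_analyticAt {f : Plane → ℝ} {p : Plane} (hf : AnalyticAt ℝ f p) (i : Fin 2) :
    AnalyticAt ℝ (partialD i f) p :=
  (ContinuousLinearMap.apply ℝ ℝ (EuclideanSpace.single i (1 : ℝ))).analyticAt _ |>.comp hf.fderiv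

theorem partialD_congr {f g : Plane → ℝ} {p : Plane} (h : f =ᶠ[𝓝 p] g) (i : Fin 2) :
    partialD i f =ᶠ[𝓝 p] partialD i g := by
  filter_upwards [h.fderiv (𝕜 := ℝ)] with q hq
  rw [partialD, partialD, hq]

theorem partialD_add {f g : Plane → ℝ} {p : Plane} (hf : DifferentiableAt ℝ f p)
    (hg : DifferentiableAt ℝ g p) (i : Fin 2) :
    partialD i (f + g) p = partialD i f p + partialD i g p := by
  rw [partialD, fderiv_add hf hg]; rfl

theorem partialD_sub {f g : Plane → ℝ} {p : Plane} (hf : DifferentiableAt ℝ f p)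
    (hg : DifferentiableAt ℝ g p) (i : Fin 2) :
    partialD i (f - g) p = partialD i f p - partialD i g p := by
  rw [partialD, fderiv_sub hf hg]; rfl

theorem partialD_mul {f g : Plane → ℝ} {p : Plane} (hf : DifferentiableAt ℝ f p)
    (hg : DifferentiableAt ℝ g p) (i : Fin 2) :
    partialD i (f * g) p = f p * partialD i g p + partialD i f p * g p := by
  rw [partialD, fderiv_mul hf hg, partialD, partialD]
  simp; ring

theorem partialD_const (c : ℝ) (i : Fin 2) : partialD i (fun _ => c) = 0 := by
  ext p; simp [partialD]

theorem AnalyticAt.eventually_differentiableAt {f : Plane → ℝ} {p : Plane} (hf : AnalyticAt ℝ f p) :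
    ∀ᶠ q in 𝓝 p, DifferentiableAt ℝ f q :=
  hf.eventually_analyticAt.mono fun _ h => h.differentiableAt

theorem partialD_add_eventuallyEq {f g : Plane → ℝ} {p : Plane} (hf : AnalyticAt ℝ f p)
    (hg : AnalyticAt ℝ g p) (i : Fin 2) :
    partialD i (f + g) =ᶠ[𝓝 p] partialD i f + partialD i g := by
  filter_upwards [AnalyticAt.eventually_differentiableAt hf,
    AnalyticAt.eventually_differentiableAt hg] with q h1 h2
  exact partialD_add h1 h2 i

theorem partialD_sub_eventuallyEq {f g : Plane → ℝ} {p : Plane} (hf : AnalyticAt ℝ f p)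
    (hg : AnalyticAt ℝ g p) (i : Fin 2) :
    partialD i (f - g) =ᶠ[𝓝 p] partialD i f - partialD i g := by
  filter_upwards [AnalyticAt.eventually_differentiableAt hf,
    AnalyticAt.eventually_differentiableAt hg] with q h1 h2
  exact partialD_sub h1 h2 i

theorem partialD_mul_eventuallyEq {f g : Plane → ℝ} {p : Plane} (hf : AnalyticAt ℝ f p)
    (hg : AnalyticAt ℝ g p) (i : Fin 2) :
    partialD i (f * g) =ᶠ[𝓝 p] f * partialD i g + partialD i f * g := by
  filter_upwards [AnalyticAt.eventually_differentiableAt hf,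
    AnalyticAt.eventually_differentiableAt hg] with q h1 h2
  exact partialD_mul h1 h2 i

theorem partialD_partialD_apply {f : Plane → ℝ} {p : Plane} (hf : AnalyticAt ℝ f p) (i j : Fin 2) :
    partialD i (partialD j f) p
      = fderiv ℝ (fderiv ℝ f) p (EuclideanSpace.single i 1) (EuclideanSpace.single j 1) := by
  have hd : DifferentiableAt ℝ (fderiv ℝ f) p := hf.fderiv.differentiableAt
  have : partialD j f = fun q => fderiv ℝ f q (EuclideanSpace.single j 1) := rfl
  rw [this, partialD, fderiv_clm_apply hd (differentiableAt_const _)]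
  simp

theorem partialD_comm {f : Plane → ℝ} {p : Plane} (hf : AnalyticAt ℝ f p) (i j : Fin 2) :
    partialD i (partialD j f) p = partialD j (partialD i f) p := by
  rw [partialD_partialD_apply hf, partialD_partialD_apply hf]
  have : IsSymmSndFDerivAt ℝ f p :=
    (hf.contDiffAt (n := 2)).isSymmSndFDerivAt (by simp)
  exact this _ _

theorem laplacian_eq {f : Plane → ℝ} {p : Plane} (hf : AnalyticAt ℝ f p) :
    Laplacian.laplacian f p = partialD 0 (partialD 0 f) p + partialD 1 (partialD 1 f) p := by
  rw [partialD_partialD_apply hf, partialD_partialD_apply hf,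
    InnerProductSpace.laplacian_eq_iteratedFDeriv_orthonormalBasis f (EuclideanSpace.basisFun (Fin 2) ℝ)]
  simp [iteratedFDeriv_two_apply]

/-! ### Polynomial functions -/

theorem polyFun_add (v w : Poly) : polyFun (v + w) = polyFun v + polyFun w := by
  ext p; simp [polyFun]

theorem polyFun_sub (v w : Poly) : polyFun (v - w) = polyFun v - polyFun w := by
  ext p; simp [polyFun]

theorem polyFun_mul (v w : Poly) : polyFun (v * w) = polyFun v * polyFun w := by
  ext p; simp [polyFun]

theorem polyFun_C (c : ℝ) : polyFun (MvPolynomial.C c) = fun _ => c := by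
  ext p; simp [polyFun]

theorem polyFun_zero : polyFun 0 = 0 := by
  ext p; simp [polyFun]

theorem polyFun_X (i : Fin 2) : polyFun (MvPolynomial.X i) = fun p => p i := by
  ext p; simp [polyFun]

theorem polyFun_analyticAt (w : Poly) (p : Plane) : AnalyticAt ℝ (polyFun w) p := by
  induction w using MvPolynomial.induction_on with
  | C a => rw [polyFun_C]; exact analyticAt_const
  | add p q hp hq => rw [polyFun_add]; exact hp.add hq
  | mul_X p i hp =>
    rw [polyFun_mul, polyFun_X]
    exact hp.mul ((EuclideanSpace.proj (𝕜 := ℝ) i : Plane →L[ℝ] ℝ).analyticAt _)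

theorem partialD_polyFun (w : Poly) (i : Fin 2) :
    partialD i (polyFun w) = polyFun (MvPolynomial.pderiv i w) := by
  induction w using MvPolynomial.induction_on with
  | C a => rw [polyFun_C, partialD_const]; simp [polyFun_zero]
  | add v w hv hw =>
    ext p
    rw [polyFun_add, partialD_add (polyFun_analyticAt _ _).differentiableAt
      (polyFun_analyticAt _ _).differentiableAt, map_add, polyFun_add, hv, hw]
    rfl
  | mul_X v j hv =>
    ext p
    have hX : partialD i (polyFun (MvPolynomial.X j)) p
        = polyFun (MvPolynomial.pderiv i (MvPolynomial.X j)) p := by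
      rw [polyFun_X, partialD, show (fun p : Plane => p j) = (EuclideanSpace.proj (𝕜 := ℝ) j : Plane →L[ℝ] ℝ)
        from rfl, ContinuousLinearMap.fderiv, MvPolynomial.pderiv_X]
      by_cases h : j = i
      · subst h; simp [polyFun]
      · simp [polyFun, h]
    rw [polyFun_mul, partialD_mul (polyFun_analyticAt _ _).differentiableAt
      (polyFun_analyticAt _ _).differentiableAt, hX, hv, MvPolynomial.pderiv_mul, polyFun_add,
      polyFun_mul, polyFun_mul]
    simp only [Pi.add_apply, Pi.mul_apply]
    ring

theorem polyFun_apply_zero {w : Poly} {n : ℕ} (hn : n ≠ 0) (hw : w.IsHomogeneous n) :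
    polyFun w 0 = 0 := by
  have h := congrArg (fun v => polyFun v 0) (euler hw)
  simp only [polyFun, map_add, map_mul, MvPolynomial.eval_X, map_natCast] at h
  have hn' : (n : ℝ) ≠ 0 := by exact_mod_cast hn
  simpa [polyFun, hn'] using h

/-! ### Order of vanishing at the origin -/

/-- `f` is analytic at the origin and its partial derivatives of order less than `n` vanish
there. -/
def Vanishes : ℕ → (Plane → ℝ) → Prop
  | 0, f => AnalyticAt ℝ f 0
  | n + 1, f => AnalyticAt ℝ f 0 ∧ f 0 = 0 ∧ ∀ i, Vanishes n (partialD i f)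

namespace Vanishes

theorem analyticAt {n : ℕ} {f : Plane → ℝ} (h : Vanishes n f) : AnalyticAt ℝ f 0 := by
  cases n with
  | zero => exact h
  | succ n => exact h.1

theorem congr {n : ℕ} {f g : Plane → ℝ} (h : Vanishes n f) (hfg : f =ᶠ[𝓝 0] g) : Vanishes n g := by
  induction n generalizing f g with
  | zero => exact AnalyticAt.congr h hfg
  | succ n ih =>
    exact ⟨h.1.congr hfg, hfg.eq_of_nhds ▸ h.2.1, fun i => ih (h.2.2 i) (partialD_congr hfg i)⟩

theorem of_succ {n : ℕ} {f : Plane → ℝ} (h : Vanishes (n + 1) f) : Vanishes n f := by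
  induction n generalizing f with
  | zero => exact h.1
  | succ n ih => exact ⟨h.1, h.2.1, fun i => ih (h.2.2 i)⟩

theorem mono {n m : ℕ} {f : Plane → ℝ} (h : Vanishes n f) (hm : m ≤ n) : Vanishes m f := by
  induction n with
  | zero => rwa [Nat.le_zero.1 hm]
  | succ n ih =>
    rcases Nat.le_succ_iff.1 hm with h1 | rfl
    · exact ih h.of_succ h1
    · exact h

theorem partialD {n : ℕ} {f : Plane → ℝ} (h : Vanishes n f) (i : Fin 2) :
    Vanishes (n - 1) (partialD i f) := by
  cases n with
  | zero => exact partialD_analyticAt h i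
  | succ n => exact h.2.2 i

theorem zero (n : ℕ) : Vanishes n 0 := by
  induction n with
  | zero => exact analyticAt_const
  | succ n ih =>
    refine ⟨analyticAt_const, rfl, fun i => ?_⟩
    have : RadialHessian.partialD i (0 : Plane → ℝ) = 0 := partialD_const 0 i
    rwa [this]

theorem add {n : ℕ} {f g : Plane → ℝ} (hf : Vanishes n f) (hg : Vanishes n g) :
    Vanishes n (f + g) := by
  induction n generalizing f g with
  | zero => exact AnalyticAt.add hf hg
  | succ n ih =>
    refine ⟨hf.1.add hg.1, by simp [hf.2.1, hg.2.1], fun i => ?_⟩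
    exact (ih (hf.2.2 i) (hg.2.2 i)).congr (partialD_add_eventuallyEq hf.1 hg.1 i).symm

theorem sub {n : ℕ} {f g : Plane → ℝ} (hf : Vanishes n f) (hg : Vanishes n g) :
    Vanishes n (f - g) := by
  induction n generalizing f g with
  | zero => exact AnalyticAt.sub hf hg
  | succ n ih =>
    refine ⟨hf.1.sub hg.1, by simp [hf.2.1, hg.2.1], fun i => ?_⟩
    exact (ih (hf.2.2 i) (hg.2.2 i)).congr (partialD_sub_eventuallyEq hf.1 hg.1 i).symm

theorem mul {n m : ℕ} {f g : Plane → ℝ} (hf : Vanishes n f) (hg : Vanishes m g) :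
    Vanishes (n + m) (f * g) := by
  induction hN : n + m generalizing n m f g with
  | zero => exact hf.analyticAt.mul hg.analyticAt
  | succ N ih =>
    refine ⟨hf.analyticAt.mul hg.analyticAt, ?_, fun i => ?_⟩
    · cases n with
      | succ n => simp [hf.2.1]
      | zero =>
        cases m with
        | zero => omega
        | succ m => simp [hg.2.1]
    · refine Vanishes.congr ?_ (partialD_mul_eventuallyEq hf.analyticAt hg.analyticAt i).symm
      refine add ?_ ?_
      · cases m with
        -- The truncated order `0 - 1 = 0` does not drop, so one order of `f` is given up instead.
        | zero => exact ih (hf.mono (Nat.sub_le n 1)) (hg.partialD i) (by omega)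
        | succ m => exact ih hf (hg.partialD i) (by omega)
      · cases n with
        | zero => exact ih (hf.partialD i) (hg.mono (Nat.sub_le m 1)) (by omega)
        | succ n => exact ih (hf.partialD i) hg (by omega)

theorem polyFun {w : Poly} {n : ℕ} (hw : w.IsHomogeneous n) : Vanishes n (polyFun w) := by
  induction n generalizing w with
  | zero => exact polyFun_analyticAt w 0
  | succ n ih =>
    refine ⟨polyFun_analyticAt w 0, polyFun_apply_zero n.succ_ne_zero hw, fun i => ?_⟩
    rw [partialD_polyFun]
    exact ih hw.pderiv

end Vanishes

theorem eq_zero_of_vanishes {w : Poly} {n : ℕ} (hw : w.IsHomogeneous n)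
    (h : Vanishes (n + 1) (polyFun w)) : w = 0 := by
  induction n generalizing w with
  | zero =>
    rw [← MvPolynomial.totalDegree_zero_iff_isHomogeneous,
      MvPolynomial.totalDegree_eq_zero_iff_eq_C] at hw
    have h0 := h.2.1
    rw [hw, polyFun_C] at h0
    rw [hw, show MvPolynomial.coeff 0 w = 0 from h0, map_zero]
  | succ n ih =>
    have h1 : ∀ i, MvPolynomial.pderiv i w = 0 := fun i =>
      ih hw.pderiv (by rw [← partialD_polyFun]; exact h.2.2 i)
    have e := euler hw
    rw [h1, h1, mul_zero, mul_zero, add_zero] at e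
    refine (mul_eq_zero.1 e.symm).resolve_left ?_
    exact Nat.cast_ne_zero.2 n.succ_ne_zero

/-- `P` is the homogeneous Taylor polynomial of degree `n` of `f` and the lower ones vanish. -/
def Leads (n : ℕ) (f : Plane → ℝ) (P : Poly) : Prop :=
  P.IsHomogeneous n ∧ Vanishes (n + 1) (f - polyFun P)

namespace Leads

theorem vanishes {n : ℕ} {f : Plane → ℝ} {P : Poly} (h : Leads n f P) : Vanishes n f := by
  have := h.2.of_succ.add (Vanishes.polyFun h.1)
  rwa [sub_add_cancel] at this

theorem of_vanishes {n : ℕ} {f : Plane → ℝ} (h : Vanishes (n + 1) f) : Leads n f 0 :=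
  ⟨MvPolynomial.isHomogeneous_zero _ _ _, by rwa [polyFun_zero, sub_zero]⟩

theorem polyFun {n : ℕ} {P : Poly} (hP : P.IsHomogeneous n) : Leads n (polyFun P) P :=
  ⟨hP, by rw [sub_self]; exact Vanishes.zero _⟩

theorem congr {n : ℕ} {f g : Plane → ℝ} {P : Poly} (h : Leads n f P) (hfg : f =ᶠ[𝓝 0] g) :
    Leads n g P :=
  ⟨h.1, h.2.congr (hfg.sub EventuallyEq.rfl)⟩

theorem add {n : ℕ} {f g : Plane → ℝ} {P Q : Poly} (hf : Leads n f P) (hg : Leads n g Q) :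
    Leads n (f + g) (P + Q) := by
  refine ⟨hf.1.add hg.1, ?_⟩
  rw [polyFun_add, add_sub_add_comm]
  exact hf.2.add hg.2

theorem sub {n : ℕ} {f g : Plane → ℝ} {P Q : Poly} (hf : Leads n f P) (hg : Leads n g Q) :
    Leads n (f - g) (P - Q) := by
  refine ⟨hf.1.sub hg.1, ?_⟩
  rw [polyFun_sub, sub_sub_sub_comm]
  exact hf.2.sub hg.2

theorem mul {n m : ℕ} {f g : Plane → ℝ} {P Q : Poly} (hf : Leads n f P) (hg : Leads m g Q) :
    Leads (n + m) (f * g) (P * Q) := by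
  refine ⟨hf.1.mul hg.1, ?_⟩
  rw [polyFun_mul, show f * g - RadialHessian.polyFun P * RadialHessian.polyFun Q
    = (f - RadialHessian.polyFun P) * g + RadialHessian.polyFun P * (g - RadialHessian.polyFun Q) by ring]
  refine Vanishes.add ?_ ?_
  · exact (hf.2.mul hg.vanishes).mono (by omega)
  · exact ((Vanishes.polyFun hf.1).mul hg.2).mono (by omega)

theorem partialD {n : ℕ} (hn : n ≠ 0) {f : Plane → ℝ} {P : Poly} (hf : Leads n f P) (i : Fin 2) :
    Leads (n - 1) (partialD i f) (MvPolynomial.pderiv i P) := by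
  refine ⟨hf.1.pderiv, ?_⟩
  rw [show n - 1 + 1 = n + 1 - 1 by omega, ← partialD_polyFun]
  exact (hf.2.partialD i).congr
    (partialD_sub_eventuallyEq hf.vanishes.analyticAt (polyFun_analyticAt P 0) i)

theorem unique {n : ℕ} {f : Plane → ℝ} {P Q : Poly} (hf : Leads n f P) (hg : Leads n f Q) :
    P = Q := by
  have h := hf.sub hg
  rw [sub_self] at h
  have h2 := (Vanishes.zero (n + 1)).sub h.2
  rw [zero_sub, neg_sub, sub_zero] at h2
  exact sub_eq_zero.1 (eq_zero_of_vanishes h.1 h2)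

end Leads

/-- The leading forms `P 0`, `P 1` of `f_x`, `f_y` make a closed 1-form because mixed partials
commute; its homogeneous potential is the leading form of `f`. -/
theorem Vanishes.exists_leads {n : ℕ} {f : Plane → ℝ} (hf : Vanishes n f) : ∃ P, Leads n f P := by
  induction n generalizing f with
  | zero =>
    refine ⟨MvPolynomial.C (f 0), MvPolynomial.isHomogeneous_C _ _, ?_⟩
    have ha := AnalyticAt.sub hf (polyFun_analyticAt (MvPolynomial.C (f 0)) 0)
    exact ⟨ha, by simp [polyFun_C], fun i => partialD_analyticAt ha i⟩
  | succ n ih =>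
    choose P hP using fun i => ih (hf.2.2 i)
    have hcomm : MvPolynomial.pderiv 0 (P 1) = MvPolynomial.pderiv 1 (P 0) := by
      rcases Nat.eq_zero_or_pos n with rfl | hn
      · have h : ∀ i j, MvPolynomial.pderiv i (P j) = 0 := by
          intro i j
          have h := (hP j).1
          rw [← MvPolynomial.totalDegree_zero_iff_isHomogeneous,
            MvPolynomial.totalDegree_eq_zero_iff_eq_C] at h
          rw [h]; simp
        rw [h, h]
      · have h1 := (hP 1).partialD hn.ne' 0
        have h2 := (hP 0).partialD hn.ne' 1
        refine h1.unique (h2.congr ?_)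
        filter_upwards [hf.1.eventually_analyticAt] with q hq
        exact partialD_comm hq 1 0
    -- By Euler's relation and closedness, `∂_i (x P₀ + y P₁) = (n + 1) P_i`.
    set Q : Poly := MvPolynomial.C ((n : ℝ) + 1)⁻¹ *
      (MvPolynomial.X 0 * P 0 + MvPolynomial.X 1 * P 1) with hQ
    have hQh : Q.IsHomogeneous (n + 1) := by
      refine MvPolynomial.IsHomogeneous.C_mul ?_ _
      rw [add_comm n 1]
      exact ((MvPolynomial.isHomogeneous_X _ _).mul (hP 0).1).add
        ((MvPolynomial.isHomogeneous_X _ _).mul (hP 1).1)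
    have hn1 : (MvPolynomial.C ((n : ℝ) + 1)⁻¹ : Poly) * (n + 1) = 1 := by
      rw [← map_natCast (MvPolynomial.C (σ := Fin 2) (R := ℝ)) n, ← MvPolynomial.C_1,
        ← MvPolynomial.C_add, ← MvPolynomial.C_mul, inv_mul_cancel₀ (by positivity)]
    have hpd : ∀ i, MvPolynomial.pderiv i Q = P i := by
      have h10 : MvPolynomial.pderiv 1 (MvPolynomial.X 0 : Poly) = 0 :=
        MvPolynomial.pderiv_X_of_ne (by decide)
      have h01 : MvPolynomial.pderiv 0 (MvPolynomial.X 1 : Poly) = 0 :=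
        MvPolynomial.pderiv_X_of_ne (by decide)
      intro i
      have e0 := euler (hP 0).1
      have e1 := euler (hP 1).1
      fin_cases i
      · simp only [Fin.zero_eta, hQ, MvPolynomial.pderiv_mul, map_add, MvPolynomial.pderiv_C,
          MvPolynomial.pderiv_X_self, h01, hcomm]
        linear_combination MvPolynomial.C ((n : ℝ) + 1)⁻¹ * e0 + P 0 * hn1
      · simp only [Fin.mk_one, hQ, MvPolynomial.pderiv_mul, map_add, MvPolynomial.pderiv_C,
          MvPolynomial.pderiv_X_self, h10, ← hcomm]
        linear_combination MvPolynomial.C ((n : ℝ) + 1)⁻¹ * e1 + P 1 * hn1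
    refine ⟨Q, hQh, hf.1.sub (polyFun_analyticAt _ _), ?_, fun i => ?_⟩
    · simp [hf.2.1, polyFun_apply_zero n.succ_ne_zero hQh]
    · refine (hP i).2.congr ?_
      have := partialD_sub_eventuallyEq hf.1 (polyFun_analyticAt Q 0) i
      rw [partialD_polyFun, hpd] at this
      exact this.symm

end VanishingOrder

/-! ### Growth estimates, flat analytic germs, and leading terms of the operators. -/

section Germs

theorem fderiv_apply_eq (f : Plane → ℝ) (p v : Plane) :
    fderiv ℝ f p v = v 0 * partialD 0 f p + v 1 * partialD 1 f p := by
  have hv : v = v 0 • EuclideanSpace.single 0 1 + v 1 • EuclideanSpace.single 1 1 := by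
    ext i; fin_cases i <;> simp
  conv_lhs => rw [hv]
  rw [map_add, map_smul, map_smul]; rfl

theorem norm_fderiv_le (f : Plane → ℝ) (p : Plane) :
    ‖fderiv ℝ f p‖ ≤ |partialD 0 f p| + |partialD 1 f p| := by
  refine ContinuousLinearMap.opNorm_le_bound _ (by positivity) fun v => ?_
  have h0 : |v 0| ≤ ‖v‖ := PiLp.norm_apply_le v 0
  have h1 : |v 1| ≤ ‖v‖ := PiLp.norm_apply_le v 1
  rw [fderiv_apply_eq, Real.norm_eq_abs]
  calc |v 0 * partialD 0 f p + v 1 * partialD 1 f p|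
      ≤ |v 0| * |partialD 0 f p| + |v 1| * |partialD 1 f p| := by
        rw [← abs_mul, ← abs_mul]; exact abs_add_le _ _
    _ ≤ ‖v‖ * |partialD 0 f p| + ‖v‖ * |partialD 1 f p| := by gcongr
    _ = _ := by ring

/-- Induction by the mean value inequality on the closed ball of radius `‖p‖`, each integration
gaining one power. -/
theorem Vanishes.isBigO {n : ℕ} {f : Plane → ℝ} (h : Vanishes n f) :
    f =O[𝓝 0] fun p => ‖p‖ ^ n := by
  induction n generalizing f with
  | zero =>
    simpa using h.analyticAt.continuousAt.isBigO_one ℝ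
  | succ n ih =>
    obtain ⟨c0, hc0⟩ := (ih (h.2.2 0)).bound
    obtain ⟨c1, hc1⟩ := (ih (h.2.2 1)).bound
    obtain ⟨r, hr, hb⟩ := Metric.eventually_nhds_iff_ball.1
      ((hc0.and hc1).and (AnalyticAt.eventually_differentiableAt h.1))
    refine IsBigO.of_bound (|c0| + |c1|) ?_
    filter_upwards [Metric.ball_mem_nhds (0 : Plane) hr] with p hp
    have hpr : ‖p‖ < r := by simpa using hp
    have hmv := (convex_closedBall (0 : Plane) ‖p‖).norm_image_sub_le_of_norm_fderiv_le (𝕜 := ℝ)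
      (f := f) (C := (|c0| + |c1|) * ‖p‖ ^ n) (x := 0) (y := p)
      (fun q hq => (hb q (by
        rw [mem_closedBall_zero_iff] at hq
        rw [mem_ball_zero_iff]; exact hq.trans_lt hpr)).2)
      (fun q hq => by
        rw [mem_closedBall_zero_iff] at hq
        obtain ⟨⟨h0, h1⟩, -⟩ := hb q (by rw [mem_ball_zero_iff]; exact hq.trans_lt hpr)
        have hqn : ‖q‖ ^ n ≤ ‖p‖ ^ n := by gcongr
        rw [Real.norm_eq_abs, norm_pow, norm_norm] at h0 h1
        calc ‖fderiv ℝ f q‖ ≤ _ := norm_fderiv_le f q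
          _ ≤ c0 * ‖q‖ ^ n + c1 * ‖q‖ ^ n := add_le_add h0 h1
          _ ≤ |c0| * ‖p‖ ^ n + |c1| * ‖p‖ ^ n := by
            gcongr
            · exact le_abs_self _
            · exact le_abs_self _
          _ = _ := by ring)
      (by simp) (by simp)
    rw [h.2.1, sub_zero, sub_zero] at hmv
    rw [norm_pow, norm_norm, pow_succ, ← mul_assoc]
    exact hmv

theorem polyFun_smul {P : Poly} {n : ℕ} (hP : P.IsHomogeneous n) (t : ℝ) (p : Plane) :
    polyFun P (t • p) = t ^ n * polyFun P p := by
  induction n generalizing P with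
  | zero =>
    rw [← MvPolynomial.totalDegree_zero_iff_isHomogeneous,
      MvPolynomial.totalDegree_eq_zero_iff_eq_C] at hP
    rw [hP, polyFun_C]; simp
  | succ n ih =>
    have e := fun q => congrArg (fun v => polyFun v q) (euler hP)
    simp only [polyFun, map_add, map_mul, MvPolynomial.eval_X, map_natCast] at e
    have h0 := ih (hP.pderiv (i := 0))
    have h1 := ih (hP.pderiv (i := 1))
    simp only [polyFun] at h0 h1 ⊢
    have e1 := e (t • p)
    have e2 := e p
    rw [h0, h1] at e1
    have hn : ((n + 1 : ℕ) : ℝ) ≠ 0 := by positivity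
    apply mul_left_cancel₀ hn
    rw [← e1]
    simp only [PiLp.smul_apply, smul_eq_mul]
    linear_combination t ^ (n + 1) * e2

theorem eq_zero_of_polyFun_isLittleO {P : Poly} {n : ℕ} (hP : P.IsHomogeneous n)
    (h : polyFun P =o[𝓝 0] fun p : Plane => ‖p‖ ^ n) : P = 0 := by
  have hz : ∀ x : Plane, polyFun P x = 0 := by
    intro x
    by_contra hx
    have hpos : 0 < |polyFun P x| := abs_pos.2 hx
    -- This `ε` makes `ε ‖x‖^n` less than `|P x|`; the `+ 1` keeps the denominator positive when
    -- `‖x‖^n` vanishes.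
    have hε : 0 < |polyFun P x| / (2 * (‖x‖ ^ n + 1)) := by positivity
    have ht : Tendsto (fun t : ℝ => t • x) (𝓝[>] 0) (𝓝 0) := by
      have : Tendsto (fun t : ℝ => t • x) (𝓝 0) (𝓝 ((0 : ℝ) • x)) :=
        (continuous_id.smul continuous_const).tendsto _
      rw [zero_smul] at this
      exact this.mono_left nhdsWithin_le_nhds
    obtain ⟨t, hb, ht0⟩ := ((ht.eventually (h.bound hε)).and self_mem_nhdsWithin).exists
    replace ht0 : 0 < t := ht0
    rw [polyFun_smul hP, norm_mul, norm_pow, norm_pow, norm_norm, norm_smul, mul_pow,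
      Real.norm_of_nonneg ht0.le, Real.norm_eq_abs] at hb
    have htn : 0 < t ^ n := pow_pos ht0 n
    have h2 : |polyFun P x| ≤ |polyFun P x| / (2 * (‖x‖ ^ n + 1)) * ‖x‖ ^ n := by
      apply le_of_mul_le_mul_left _ htn
      linarith
    rw [div_mul_eq_mul_div, le_div_iff₀ (by positivity)] at h2
    nlinarith [pow_nonneg (norm_nonneg x) n]
  apply MvPolynomial.funext
  intro r
  have := hz (WithLp.toLp 2 r)
  simpa [polyFun] using this

/-- As long as `n ≤ k`, the leading form of degree `n` is itself `o(ϱ^n)`, hence zero, and the order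
of vanishing rises by one. -/
theorem Vanishes.of_isLittleO {k : ℕ} {f : Plane → ℝ} (hf : AnalyticAt ℝ f 0)
    (h : f =o[𝓝 0] fun p : Plane => ‖p‖ ^ k) : Vanishes (k + 1) f := by
  have hpow : ∀ n ≤ k, (fun p : Plane => ‖p‖ ^ k) =O[𝓝 0] fun p => ‖p‖ ^ n := by
    intro n hn
    refine IsBigO.of_bound 1 ?_
    filter_upwards [Metric.ball_mem_nhds (0 : Plane) one_pos] with p hp
    have hp1 : ‖p‖ < 1 := by simpa using hp
    rw [norm_pow, norm_pow, norm_norm, one_mul]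
    exact pow_le_pow_of_le_one (norm_nonneg _) hp1.le hn
  suffices ∀ n ≤ k + 1, Vanishes n f from this _ le_rfl
  intro n
  induction n with
  | zero => exact fun _ => hf
  | succ n ih =>
    intro hn
    obtain ⟨P, hP⟩ := (ih (by omega)).exists_leads
    have h1 : f =o[𝓝 0] fun p : Plane => ‖p‖ ^ n := h.trans_isBigO (hpow n (by omega))
    have h2 : (fun p : Plane => ‖p‖ ^ (n + 1)) =o[𝓝 0] fun p : Plane => ‖p‖ ^ n := by
      have h3 : (fun p : Plane => ‖p‖) =o[𝓝 0] fun _ => (1 : ℝ) := by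
        rw [isLittleO_one_iff]
        exact tendsto_norm_zero
      simpa [pow_succ] using (isBigO_refl (fun p : Plane => ‖p‖ ^ n) (𝓝 0)).mul_isLittleO h3
    have h4 := h1.sub (hP.2.isBigO.trans_isLittleO h2)
    have h5 : RadialHessian.polyFun P =o[𝓝 0] fun p : Plane => ‖p‖ ^ n := by
      refine h4.congr_left fun p => ?_
      simp
    have := hP.2
    rwa [eq_zero_of_polyFun_isLittleO hP.1 h5, polyFun_zero, sub_zero] at this

/-- Once the lower terms of the power series are gone, the term of degree `n` is `O(‖y‖^(n + 1))`
and therefore zero. -/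
theorem eventually_eq_zero_of_vanishes {f : Plane → ℝ} (h : ∀ n, Vanishes n f) :
    ∀ᶠ p in 𝓝 0, f p = 0 := by
  obtain ⟨s, r, hs⟩ := (h 0).analyticAt
  have hz : ∀ n y, s n (fun _ => y) = 0 := by
    intro n
    induction n using Nat.strong_induction_on with
    | _ n ih =>
      have h1 := hs.hasFPowerSeriesAt.isBigO_sub_partialSum_pow (n + 1)
      have h2 : f =O[𝓝 0] fun p => ‖p‖ ^ (n + 1) := (h (n + 1)).isBigO
      have h3 : (fun y : Plane => s n fun _ => y) =O[𝓝 0] fun y => ‖y‖ ^ (n + 1) := by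
        refine (h2.sub h1).congr_left fun y => ?_
        rw [zero_add, sub_sub_cancel, FormalMultilinearSeries.partialSum, Finset.sum_range_succ,
          Finset.sum_eq_zero (fun i hi => ih i (Finset.mem_range.1 hi) y), zero_add]
      exact h3.continuousMultilinearMap_apply_eq_zero
  filter_upwards [Metric.eball_mem_nhds (0 : Plane) hs.r_pos] with y hy
  have := hs.hasSum hy
  simp only [hz, zero_add] at this
  exact this.unique hasSum_zero

/-! ### Leading terms of the differential operators -/

/-- The sum of the pure second derivatives. -/
noncomputable def lap (f : Plane → ℝ) : Plane → ℝ :=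
  partialD 0 (partialD 0 f) + partialD 1 (partialD 1 f)

/-- The polarised Hessian determinant. -/
noncomputable def mixedHess (f g : Plane → ℝ) : Plane → ℝ :=
  partialD 0 (partialD 0 f) * partialD 1 (partialD 1 g)
    + partialD 1 (partialD 1 f) * partialD 0 (partialD 0 g)
    - (partialD 1 (partialD 0 f) * partialD 1 (partialD 0 g)
      + partialD 1 (partialD 0 f) * partialD 1 (partialD 0 g))

theorem hessianDet_eq (f : Plane → ℝ) : hessianDet f =
    partialD 0 (partialD 0 f) * partialD 1 (partialD 1 f)
      - partialD 1 (partialD 0 f) * partialD 1 (partialD 0 f) := by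
  ext p; simp [hessianDet, pow_two]

theorem jacobian_eq (f g : Plane → ℝ) : jacobian f g =
    partialD 0 f * partialD 1 g - partialD 1 f * partialD 0 g := by
  ext p; simp [jacobian]

namespace Leads

theorem second {n : ℕ} {f : Plane → ℝ} {P : Poly} (h : Leads (n + 2) f P) (i j : Fin 2) :
    Leads n (RadialHessian.partialD i (RadialHessian.partialD j f))
      (MvPolynomial.pderiv i (MvPolynomial.pderiv j P)) :=
  (h.partialD (by omega) j).partialD (by omega) i

theorem lap {n : ℕ} {f : Plane → ℝ} {P : Poly} (h : Leads (n + 2) f P) :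
    Leads n (lap f) (polyLap P) :=
  (h.second 0 0).add (h.second 1 1)

theorem mixedHess {n m : ℕ} {f g : Plane → ℝ} {P Q : Poly} (hf : Leads (n + 2) f P)
    (hg : Leads (m + 2) g Q) : Leads (n + m) (mixedHess f g) (polyMixedHess P Q) := by
  rw [polyMixedHess, two_mul]
  exact (((hf.second 0 0).mul (hg.second 1 1)).add ((hf.second 1 1).mul (hg.second 0 0))).sub
    (((hf.second 1 0).mul (hg.second 1 0)).add ((hf.second 1 0).mul (hg.second 1 0)))

theorem hessianDet {n : ℕ} {f : Plane → ℝ} {P : Poly} (hf : Leads (n + 2) f P) :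
    Leads (n + n) (hessianDet f) (polyHess P) := by
  rw [polyHess, hessianDet_eq, pow_two]
  exact ((hf.second 0 0).mul (hf.second 1 1)).sub ((hf.second 1 0).mul (hf.second 1 0))

theorem jacobian {n m : ℕ} {f g : Plane → ℝ} {P Q : Poly} (hf : Leads (n + 1) f P)
    (hg : Leads (m + 1) g Q) : Leads (n + m) (jacobian f g) (polyJac P Q) := by
  rw [jacobian_eq, polyJac]
  exact ((hf.partialD (by omega) 0).mul (hg.partialD (by omega) 1)).sub
    ((hf.partialD (by omega) 1).mul (hg.partialD (by omega) 0))

end Leads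

end Germs

/-! ### Radiality of the Taylor expansion. -/

section FormalRadiality

open MvPolynomial (pderiv C X)

/-! ### Rotation invariance of the operators on polynomials -/

theorem pderiv_X_one_zero : pderiv 1 (X 0 : Poly) = 0 := MvPolynomial.pderiv_X_of_ne (by decide)

theorem pderiv_X_zero_one : pderiv 0 (X 1 : Poly) = 0 := MvPolynomial.pderiv_X_of_ne (by decide)

theorem polyRot_polyLap (R : Poly) : polyRot (polyLap R) = polyLap (polyRot R) := by
  simp only [polyRot, polyLap, map_add, map_sub, MvPolynomial.pderiv_mul, pderiv_X_one_zero,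
    pderiv_X_zero_one, MvPolynomial.pderiv_X_self, pderiv_comm 0 1]
  simp only [MvPolynomial.pderiv_one, map_zero]
  ring

theorem polyRot_polyHess (R : Poly) : polyRot (polyHess R) = polyMixedHess R (polyRot R) := by
  simp only [polyRot, polyHess, polyMixedHess, map_add, map_sub, MvPolynomial.pderiv_mul,
    MvPolynomial.pderiv_pow, pderiv_X_one_zero,
    pderiv_X_zero_one, MvPolynomial.pderiv_X_self, pderiv_comm 0 1]
  simp only [MvPolynomial.pderiv_one, map_zero]
  push_cast
  ring

/-- Both gradients are orthogonal to `(-y, x)`, hence parallel; the factor `X 0` is cancelled at the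
end. -/
theorem polyJac_eq_zero_of_polyRot {f g : Poly} (hf : polyRot f = 0) (hg : polyRot g = 0) :
    polyJac f g = 0 := by
  rw [polyRot] at hf hg
  apply (mul_eq_zero.1 ?_).resolve_left (MvPolynomial.X_ne_zero (R := ℝ) (0 : Fin 2))
  rw [polyJac]
  linear_combination (pderiv 0 f) * hg - pderiv 0 g * hf

/-- `Δ` and `H` are rotation invariant, so they send radial polynomials to radial ones. This removes
the zeroth-order term of the perturbation. -/
theorem polyJac_polyLap_polyHess_eq_zero {R : Poly} (hR : polyRot R = 0) :
    polyJac (polyLap R) (polyHess R) = 0 := by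
  apply polyJac_eq_zero_of_polyRot
  · rw [polyRot_polyLap, hR]; simp [polyLap]
  · rw [polyRot_polyHess, hR]; simp [polyMixedHess]

theorem polyLap_C_mul (a : ℝ) (f : Poly) : polyLap (C a * f) = C a * polyLap f := by
  simp only [polyLap, MvPolynomial.pderiv_C_mul]; ring

theorem polyHess_C_mul (a : ℝ) (f : Poly) : polyHess (C a * f) = C a ^ 2 * polyHess f := by
  simp only [polyHess, MvPolynomial.pderiv_C_mul]; ring

theorem polyMixedHess_C_mul (a : ℝ) (f g : Poly) :
    polyMixedHess (C a * f) g = C a * polyMixedHess f g := by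
  simp only [polyMixedHess, MvPolynomial.pderiv_C_mul]; ring

theorem polyJac_C_mul_C_mul (a b : ℝ) (f g : Poly) :
    polyJac (C a * f) (C b * g) = C a * C b * polyJac f g := by
  simp only [polyJac, MvPolynomial.pderiv_C_mul]; ring

/-! ### Expansion of the operators on analytic functions -/

theorem lap_analyticAt {f : Plane → ℝ} {p : Plane} (hf : AnalyticAt ℝ f p) :
    AnalyticAt ℝ (lap f) p :=
  (partialD_analyticAt (partialD_analyticAt hf 0) 0).add
    (partialD_analyticAt (partialD_analyticAt hf 1) 1)

theorem mixedHess_analyticAt {f g : Plane → ℝ} {p : Plane} (hf : AnalyticAt ℝ f p)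
    (hg : AnalyticAt ℝ g p) : AnalyticAt ℝ (mixedHess f g) p := by
  have h1 := fun i j => partialD_analyticAt (partialD_analyticAt hf i) j
  have h2 := fun i j => partialD_analyticAt (partialD_analyticAt hg i) j
  exact (((h1 _ _).mul (h2 _ _)).add ((h1 _ _).mul (h2 _ _))).sub
    (((h1 _ _).mul (h2 _ _)).add ((h1 _ _).mul (h2 _ _)))

theorem hessianDet_analyticAt {f : Plane → ℝ} {p : Plane} (hf : AnalyticAt ℝ f p) :
    AnalyticAt ℝ (hessianDet f) p := by
  have h1 := fun i j => partialD_analyticAt (partialD_analyticAt hf i) j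
  rw [hessianDet_eq]
  exact ((h1 _ _).mul (h1 _ _)).sub ((h1 _ _).mul (h1 _ _))

theorem partialD_partialD_add_eventuallyEq {f g : Plane → ℝ} {p : Plane} (hf : AnalyticAt ℝ f p)
    (hg : AnalyticAt ℝ g p) (i j : Fin 2) :
    partialD i (partialD j (f + g))
      =ᶠ[𝓝 p] partialD i (partialD j f) + partialD i (partialD j g) :=
  (partialD_congr (partialD_add_eventuallyEq hf hg j) i).trans
    (partialD_add_eventuallyEq (partialD_analyticAt hf j) (partialD_analyticAt hg j) i)

theorem lap_add_eventuallyEq {f g : Plane → ℝ} {p : Plane} (hf : AnalyticAt ℝ f p)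
    (hg : AnalyticAt ℝ g p) : lap (f + g) =ᶠ[𝓝 p] lap f + lap g := by
  filter_upwards [partialD_partialD_add_eventuallyEq hf hg 0 0,
    partialD_partialD_add_eventuallyEq hf hg 1 1] with q h0 h1
  simp only [lap, Pi.add_apply] at h0 h1 ⊢
  rw [h0, h1]; ring

theorem hessianDet_add_eventuallyEq {f g : Plane → ℝ} {p : Plane} (hf : AnalyticAt ℝ f p)
    (hg : AnalyticAt ℝ g p) :
    hessianDet (f + g) =ᶠ[𝓝 p] hessianDet f + (mixedHess f g + hessianDet g) := by
  filter_upwards [partialD_partialD_add_eventuallyEq hf hg 0 0,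
    partialD_partialD_add_eventuallyEq hf hg 1 1,
    partialD_partialD_add_eventuallyEq hf hg 1 0] with q h0 h1 h2
  simp only [hessianDet, mixedHess, Pi.add_apply, Pi.sub_apply, Pi.mul_apply] at h0 h1 h2 ⊢
  rw [h0, h1, h2]; ring

theorem jacobian_congr {f f' g g' : Plane → ℝ} {p : Plane} (hf : f =ᶠ[𝓝 p] f')
    (hg : g =ᶠ[𝓝 p] g') : jacobian f g =ᶠ[𝓝 p] jacobian f' g' := by
  filter_upwards [partialD_congr hf 0, partialD_congr hf 1, partialD_congr hg 0,
    partialD_congr hg 1] with q h1 h2 h3 h4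
  rw [jacobian, jacobian, h1, h2, h3, h4]

theorem jacobian_add_left_eventuallyEq {f g h : Plane → ℝ} {p : Plane} (hf : AnalyticAt ℝ f p)
    (hg : AnalyticAt ℝ g p) : jacobian (f + g) h =ᶠ[𝓝 p] jacobian f h + jacobian g h := by
  filter_upwards [partialD_add_eventuallyEq hf hg 0, partialD_add_eventuallyEq hf hg 1] with q h1 h2
  simp only [jacobian, Pi.add_apply] at h1 h2 ⊢
  rw [h1, h2]; ring

theorem jacobian_add_right_eventuallyEq {f g h : Plane → ℝ} {p : Plane} (hf : AnalyticAt ℝ f p)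
    (hg : AnalyticAt ℝ g p) : jacobian h (f + g) =ᶠ[𝓝 p] jacobian h f + jacobian h g := by
  filter_upwards [partialD_add_eventuallyEq hf hg 0, partialD_add_eventuallyEq hf hg 1] with q h1 h2
  simp only [jacobian, Pi.add_apply] at h1 h2 ⊢
  rw [h1, h2]; ring

/-- In this grouping `Δg` is paired with the whole of `H(f + g)`, so its contribution is read off
from the leading form of `H(f + g)` alone. -/
theorem jacobian_lap_hessianDet_add {f g : Plane → ℝ} {p : Plane} (hf : AnalyticAt ℝ f p)
    (hg : AnalyticAt ℝ g p) :
    jacobian (lap (f + g)) (hessianDet (f + g)) =ᶠ[𝓝 p]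
      jacobian (lap f) (hessianDet f) + (jacobian (lap f) (mixedHess f g + hessianDet g)
        + jacobian (lap g) (hessianDet (f + g))) := by
  have h1 := (jacobian_congr (lap_add_eventuallyEq hf hg)
    (EventuallyEq.refl _ (hessianDet (f + g)))).trans
    (jacobian_add_left_eventuallyEq (lap_analyticAt hf) (lap_analyticAt hg))
  have h2 := (jacobian_congr (EventuallyEq.refl _ (lap f))
    (hessianDet_add_eventuallyEq hf hg)).trans
    (jacobian_add_right_eventuallyEq (hessianDet_analyticAt hf)
      ((mixedHess_analyticAt hf hg).add (hessianDet_analyticAt hg)))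
  filter_upwards [h1, h2] with q h1 h2
  simp only [Pi.add_apply] at h1 h2 ⊢
  rw [h1, h2]; ring

theorem lap_polyFun (R : Poly) : lap (polyFun R) = polyFun (polyLap R) := by
  simp only [lap, partialD_polyFun, polyLap, polyFun_add]

theorem hessianDet_polyFun (R : Poly) : hessianDet (polyFun R) = polyFun (polyHess R) := by
  simp only [hessianDet_eq, partialD_polyFun, polyHess, polyFun_sub, polyFun_mul, pow_two]

theorem jacobian_polyFun (f g : Poly) :
    jacobian (polyFun f) (polyFun g) = polyFun (polyJac f g) := by
  simp only [jacobian_eq, partialD_polyFun, polyJac, polyFun_sub, polyFun_mul]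

/-- Subtracting a multiple of `x² + y²` does not change `J[Δu, H(u)]`. -/
theorem jacobian_lap_hessianDet_sub_sqNorm {u : Plane → ℝ} {p : Plane} (hu : AnalyticAt ℝ u p)
    (c : ℝ) :
    jacobian (lap (u + polyFun (C c * sqNorm))) (hessianDet (u + polyFun (C c * sqNorm)))
      =ᶠ[𝓝 p] jacobian (lap u) (hessianDet u) := by
  set g := polyFun (C c * sqNorm) with hg
  have hga : AnalyticAt ℝ g p := polyFun_analyticAt _ _
  have hrot : polyRot (C c * sqNorm) = 0 := by
    rw [polyRot_mul, polyRot_sqNorm]; simp [polyRot]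
  have h00 : pderiv 0 (pderiv 0 (C c * sqNorm)) = C (2 * c) := by
    rw [MvPolynomial.pderiv_C_mul, MvPolynomial.pderiv_C_mul, pderiv_zero_sqNorm]
    rw [← map_ofNat C 2, MvPolynomial.pderiv_C_mul, MvPolynomial.pderiv_X_self, mul_one, ← C.map_mul]
    ring_nf
  have h11 : pderiv 1 (pderiv 1 (C c * sqNorm)) = C (2 * c) := by
    rw [MvPolynomial.pderiv_C_mul, MvPolynomial.pderiv_C_mul, pderiv_one_sqNorm]
    rw [← map_ofNat C 2, MvPolynomial.pderiv_C_mul, MvPolynomial.pderiv_X_self, mul_one, ← C.map_mul]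
    ring_nf
  have h10 : pderiv 1 (pderiv 0 (C c * sqNorm)) = 0 := by
    rw [MvPolynomial.pderiv_C_mul, MvPolynomial.pderiv_C_mul, pderiv_zero_sqNorm]
    rw [← map_ofNat C 2, MvPolynomial.pderiv_C_mul, pderiv_X_one_zero, mul_zero, mul_zero]
  have hlapg : lap g = polyFun (C (4 * c)) := by
    rw [hg, lap_polyFun, polyLap, h00, h11, ← C.map_add]; ring_nf
  have hhg : hessianDet g = polyFun (C (4 * c ^ 2)) := by
    rw [hg, hessianDet_polyFun, polyHess, h00, h11, h10, ← C.map_mul]; ring_nf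
  -- Hence `H(u + g) = H(u) + 2c Δu + 4c²`, and the extra terms die since `J[Δu, Δu] = 0`.
  have hmix : mixedHess u g = polyFun (C (2 * c)) * lap u := by
    rw [mixedHess, hg]
    simp only [partialD_polyFun, h00, h11, h10, polyFun_zero, lap]
    ring
  have hcl : ∀ a i, partialD i (polyFun (C a)) = 0 := by
    intro a i; rw [polyFun_C, partialD_const]
  have hjl : ∀ a h, jacobian (polyFun (C a)) h = 0 := by
    intro a h; ext q; simp [jacobian, hcl]
  have hjr : ∀ a h, jacobian h (polyFun (C a)) = 0 := by
    intro a h; ext q; simp [jacobian, hcl]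
  have hself : jacobian (lap u) (polyFun (C (2 * c)) * lap u) =ᶠ[𝓝 p] 0 := by
    filter_upwards [partialD_mul_eventuallyEq (polyFun_analyticAt (C (2 * c)) p)
      (lap_analyticAt hu) 0, partialD_mul_eventuallyEq (polyFun_analyticAt (C (2 * c)) p)
      (lap_analyticAt hu) 1] with q h0 h1
    simp only [jacobian, h0, h1, hcl, Pi.add_apply, Pi.mul_apply, Pi.zero_apply]
    ring
  have hadd := jacobian_lap_hessianDet_add hu hga
  rw [hlapg, hjl, hhg, hmix] at hadd
  filter_upwards [hadd, hself, jacobian_add_right_eventuallyEq (h := lap u)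
    ((polyFun_analyticAt (C (2 * c)) p).mul (lap_analyticAt hu))
    (polyFun_analyticAt (C (4 * c ^ 2)) p)] with q h1 h2 h3
  rw [hjr] at h3
  simp only [Pi.add_apply, Pi.zero_apply, add_zero] at h1 h2 h3
  rw [h1, h3, h2, add_zero]

/-! ### The angular derivative -/

/-- The angular derivative `x f_y - y f_x`. -/
noncomputable def angularD (f : Plane → ℝ) : Plane → ℝ :=
  polyFun (X 0) * partialD 1 f - polyFun (X 1) * partialD 0 f

theorem angularD_polyFun (R : Poly) : angularD (polyFun R) = polyFun (polyRot R) := by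
  simp only [angularD, partialD_polyFun, polyRot, polyFun_sub, polyFun_mul]

theorem angularD_add_eventuallyEq {f g : Plane → ℝ} {p : Plane} (hf : AnalyticAt ℝ f p)
    (hg : AnalyticAt ℝ g p) : angularD (f + g) =ᶠ[𝓝 p] angularD f + angularD g := by
  filter_upwards [partialD_add_eventuallyEq hf hg 0, partialD_add_eventuallyEq hf hg 1] with q h1 h2
  simp only [angularD, Pi.add_apply, Pi.sub_apply, Pi.mul_apply] at h1 h2 ⊢
  rw [h1, h2]; ring

theorem angularD_analyticAt {f : Plane → ℝ} {p : Plane} (hf : AnalyticAt ℝ f p) :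
    AnalyticAt ℝ (angularD f) p :=
  ((polyFun_analyticAt _ p).mul (partialD_analyticAt hf 1)).sub
    ((polyFun_analyticAt _ p).mul (partialD_analyticAt hf 0))

theorem Vanishes.angularD {n : ℕ} {f : Plane → ℝ} (hf : Vanishes (n + 1) f) :
    Vanishes n (angularD f) := by
  have h : ∀ i j, Vanishes n (RadialHessian.polyFun (X i) * RadialHessian.partialD j f) := fun i j =>
    (Vanishes.mul (n := 0) (polyFun_analyticAt (X i) 0) (hf.2.2 j)).mono (by omega)
  exact (h 0 1).sub (h 1 0)

/-- The solutions of the equation which are perturbations of `a (x² + y²)^(i + 2)` of higher order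
have radial Taylor polynomials. -/
theorem exists_radial_taylor {v : Plane → ℝ}
    (hJ : jacobian (lap v) (hessianDet v) =ᶠ[𝓝 0] 0) {a : ℝ} (ha : a ≠ 0) {i : ℕ}
    (hlead : Leads (2 * i + 4) v (C a * sqNorm ^ (i + 2))) (n : ℕ) (hn : 2 * i + 4 ≤ n) :
    ∃ R : Poly, polyRot R = 0 ∧ Leads (2 * i + 4) (polyFun R) (C a * sqNorm ^ (i + 2)) ∧
      Vanishes (n + 1) (v - polyFun R) := by
  induction n, hn using Nat.le_induction with
  | base =>
    refine ⟨C a * sqNorm ^ (i + 2), ?_, Leads.polyFun hlead.1, hlead.2⟩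
    rw [polyRot_mul, polyRot_sqNorm_pow]; simp [polyRot]
  | succ n hn ih =>
    obtain ⟨R, hR, hRl, hd⟩ := ih
    set d := v - polyFun R with hdd
    obtain ⟨q, hq⟩ := hd.exists_leads
    have hvd : v = polyFun R + d := by rw [hdd]; ring
    obtain ⟨m, rfl⟩ : ∃ m, n = m + 2 := ⟨n - 2, by omega⟩
    have hlR : Leads (2 * i + 1 + 1) (lap (polyFun R)) _ := hRl.lap
    have hmix : Leads (2 * i + 2 + m + 1) (mixedHess (polyFun R) d) _ := hRl.mixedHess hq
    have hld : Leads (m + 1) (lap d) _ := hq.lap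
    -- `H(d)` vanishes to order `2m + 2`, which exceeds the degree `2i + m + 3` of the mixed term
    -- because `m ≥ 2i + 2`; it adds nothing to the leading form.
    have hhd := (Leads.of_vanishes (n := 2 * i + 2 + m + 1)
      (hq.hessianDet.vanishes.mono (show 2 * i + 2 + m + 1 + 1 ≤ m + 1 + (m + 1) by omega)))
    have hhv : Leads (4 * i + 3 + 1) (hessianDet v) (polyHess (C a * sqNorm ^ (i + 2))) := by
      have := Leads.hessianDet (n := 2 * i + 2) hlead
      rwa [show 2 * i + 2 + (2 * i + 2) = 4 * i + 3 + 1 by ring] at this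
    have h1 := hlR.jacobian (hmix.add hhd)
    have h2 := hld.jacobian hhv
    rw [show 2 * i + 1 + (2 * i + 2 + m) = m + (4 * i + 3) by ring] at h1
    have h3 := h1.add h2
    have hexp := jacobian_lap_hessianDet_add (polyFun_analyticAt R 0) hd.analyticAt
    rw [← hvd, lap_polyFun, hessianDet_polyFun, jacobian_polyFun,
      polyJac_polyLap_polyHess_eq_zero hR, polyFun_zero, zero_add] at hexp
    rw [lap_polyFun] at h3
    have h4 := (h3.congr hexp.symm).congr hJ
    -- The Jacobian is zero near the origin, so its leading form, the linearised operator at `q` up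
    -- to the factor `a²`, is zero.
    have h5 := h4.unique (Leads.of_vanishes (Vanishes.zero _))
    rw [add_zero, polyLap_C_mul, polyMixedHess_C_mul, polyHess_C_mul, polyJac_C_mul_C_mul,
      ← C.map_pow, ← one_mul (polyLap q), ← C.map_one, polyJac_C_mul_C_mul] at h5
    have hqrot : polyRot q = 0 := by
      refine polyRot_eq_zero_of_linearised (i := i) hq.1 (by omega) ?_
      have ha2 : (C a ^ 2 : Poly) ≠ 0 := pow_ne_zero _ (by simpa using ha)
      apply (mul_eq_zero.1 ?_).resolve_left ha2
      rw [C.map_pow, C.map_one] at h5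
      linear_combination h5
    refine ⟨R + q, by rw [polyRot_add, hR, hqrot, add_zero], ?_, ?_⟩
    · have h6 := hRl.add (Leads.of_vanishes ((Vanishes.polyFun hq.1).mono
        (show 2 * i + 4 + 1 ≤ m + 2 + 1 by omega)))
      rwa [add_zero, ← polyFun_add] at h6
    · have h7 := hq.2
      rwa [hdd, sub_sub, ← polyFun_add] at h7

theorem polyFun_harmonicOnNhd {w : Poly} (h : polyLap w = 0) :
    InnerProductSpace.HarmonicOnNhd (polyFun w) Set.univ := by
  intro p _
  refine ⟨(polyFun_analyticAt w p).contDiffAt, Eventually.of_forall fun q => ?_⟩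
  rw [laplacian_eq (polyFun_analyticAt w q), partialD_polyFun, partialD_polyFun, partialD_polyFun,
    partialD_polyFun, ← Pi.add_apply, ← polyFun_add, ← polyLap, h, polyFun_zero]

/-- The angular derivative of a solution with the prescribed expansion vanishes near the origin. -/
theorem angularD_eventually_eq_zero {u : Plane → ℝ} (hu : AnalyticAt ℝ u 0)
    (hJ : jacobian (lap u) (hessianDet u) =ᶠ[𝓝 0] 0) (lam : ℝ) {k : ℕ} (hk : 3 ≤ k) {w : Poly}
    (hw : w.IsHomogeneous k)
    (hharm : ¬ InnerProductSpace.HarmonicOnNhd (polyFun w) Set.univ)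
    (hlin : ¬ IsMultipleOfLinearPower w k)
    (hexp : (fun p : Plane => u p - (lam / 2 * (p 0 ^ 2 + p 1 ^ 2) + polyFun w p))
      =o[𝓝 0] (fun p : Plane => ‖p‖ ^ k)) :
    ∀ᶠ p in 𝓝 0, angularD u p = 0 := by
  set g := polyFun (C (-(lam / 2)) * sqNorm) with hg
  set v := u + g with hvdef
  have hga : AnalyticAt ℝ g 0 := polyFun_analyticAt _ _
  have hva : AnalyticAt ℝ v 0 := hu.add hga
  have hJv : jacobian (lap v) (hessianDet v) =ᶠ[𝓝 0] 0 :=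
    (jacobian_lap_hessianDet_sub_sqNorm hu _).trans hJ
  have hlead : Leads k v w := by
    refine ⟨hw, Vanishes.of_isLittleO (hva.sub (polyFun_analyticAt _ _)) (hexp.congr_left fun p => ?_)⟩
    simp [hvdef, hg, polyFun, sqNorm]
    ring
  obtain ⟨m, rfl⟩ : ∃ m, k = m + 1 + 2 := ⟨k - 3, by omega⟩
  have hPJ : polyJac (polyLap w) (polyHess w) = 0 := by
    have h := (hlead.lap.jacobian (m := m + 1 + m) hlead.hessianDet).congr hJv
    exact h.unique (Leads.of_vanishes (Vanishes.zero _))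
  have hlap : polyLap w ≠ 0 := fun h => hharm (polyFun_harmonicOnNhd h)
  obtain ⟨a, j, hj, hwa⟩ := exists_eq_C_mul_sq_add_sq_pow hk hw hPJ hlap hlin
  obtain ⟨i, rfl⟩ : ∃ i, j = i + 2 := ⟨j - 2, by omega⟩
  have ha : a ≠ 0 := by
    rintro rfl
    apply hlap
    rw [hwa]; simp [polyLap]
  rw [hwa, ← hj, show 2 * (i + 2) = 2 * i + 4 by ring] at hlead
  have hrotv : ∀ᶠ p in 𝓝 0, angularD v p = 0 := by
    apply eventually_eq_zero_of_vanishes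
    intro n
    obtain ⟨R, hR, -, hd⟩ := exists_radial_taylor hJv ha hlead (2 * i + 4 + n) (by omega)
    have h1 := (Vanishes.angularD hd).mono (show n ≤ 2 * i + 4 + n by omega)
    refine h1.congr ?_
    have h2 := angularD_add_eventuallyEq (polyFun_analyticAt R 0) hd.analyticAt
    rw [add_sub_cancel, angularD_polyFun, hR, polyFun_zero, zero_add] at h2
    exact h2.symm
  have hrotg : angularD g = 0 := by
    rw [hg, angularD_polyFun, polyRot_mul, polyRot_sqNorm]; simp [polyRot, polyFun_zero]
  filter_upwards [hrotv, angularD_add_eventuallyEq hu hga] with p h1 h2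
  rw [hrotg, add_zero] at h2
  rw [← h2]; exact h1

end FormalRadiality

/-! ### From vanishing angular derivative to a single radial profile. -/

section GlobalRadiality

/-- The identification of `ℂ` with the plane. -/
noncomputable def ofComplex : ℂ ≃ₗᵢ[ℝ] Plane := Complex.orthonormalBasisOneI.repr

theorem ofComplex_apply_zero (z : ℂ) : ofComplex z 0 = z.re := by
  simp [ofComplex]

theorem ofComplex_apply_one (z : ℂ) : ofComplex z 1 = z.im := by
  simp [ofComplex]

theorem hasDerivAt_rotation {u : Plane → ℝ} {z : ℂ} {t : ℝ}
    (hu : DifferentiableAt ℝ u (ofComplex (Complex.exp (t * Complex.I) * z))) :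
    HasDerivAt (fun s : ℝ => u (ofComplex (Complex.exp (s * Complex.I) * z)))
      (angularD u (ofComplex (Complex.exp (t * Complex.I) * z))) t := by
  have h1 : HasDerivAt (fun s : ℝ => Complex.exp (s * Complex.I) * z)
      (Complex.exp (t * Complex.I) * Complex.I * z) t := by
    have h2 : HasDerivAt (fun s : ℝ => (s : ℂ) * Complex.I) (1 * Complex.I) t :=
      (Complex.ofRealCLM.hasDerivAt (x := t)).mul_const Complex.I
    rw [one_mul] at h2
    exact h2.cexp.mul_const z
  have h3 := (ofComplex : ℂ ≃ₗᵢ[ℝ] Plane).toContinuousLinearEquiv.toContinuousLinearMap.hasFDerivAt.comp_hasDerivAt t h1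
  have h4 := hu.hasFDerivAt.comp_hasDerivAt t h3
  refine h4.congr_deriv ?_
  set y := Complex.exp (t * Complex.I) * z with hy
  change fderiv ℝ u (ofComplex y) (ofComplex (Complex.exp (t * Complex.I) * Complex.I * z)) = _
  rw [show Complex.exp (t * Complex.I) * Complex.I * z = Complex.I * y by rw [hy]; ring,
    fderiv_apply_eq, ofComplex_apply_zero, ofComplex_apply_one]
  simp only [angularD, Pi.sub_apply, Pi.mul_apply, polyFun_X, ofComplex_apply_zero,
    ofComplex_apply_one, Complex.I_mul_re, Complex.I_mul_im]
  ring

/-- `angularD u` is the derivative of `u` along rotations, so `u` is constant on an arc contained in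
the region where it vanishes. -/
theorem eq_of_angularD_eq_zero {u : Plane → ℝ} {z : ℂ} {b : ℝ}
    (h : ∀ t : ℝ, |t| ≤ |b| → DifferentiableAt ℝ u (ofComplex (Complex.exp (t * Complex.I) * z)) ∧
      angularD u (ofComplex (Complex.exp (t * Complex.I) * z)) = 0) :
    u (ofComplex (Complex.exp (b * Complex.I) * z)) = u (ofComplex z) := by
  have hmv := (convex_Icc (-|b|) |b|).norm_image_sub_le_of_norm_hasDerivWithin_le
    (f := fun s : ℝ => u (ofComplex (Complex.exp (s * Complex.I) * z))) (f' := fun _ => 0) (C := 0)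
    (x := 0) (y := b) (fun t ht => by
      obtain ⟨h1, h2⟩ := h t (abs_le.2 ht)
      have := hasDerivAt_rotation h1
      rw [h2] at this
      exact this.hasDerivWithinAt) (fun _ _ => by simp)
    ⟨by simp, by simp⟩ ⟨neg_abs_le b, le_abs_self b⟩
  rw [zero_mul, norm_le_zero_iff, sub_eq_zero] at hmv
  simpa using hmv

/-- Near each point, a function with vanishing angular derivative is a function of the radius. -/
theorem eventually_eq_radial {Ω : Set Plane} (hΩ : IsOpen Ω) {u : Plane → ℝ}
    (hu : AnalyticOnNhd ℝ u Ω) (hrot : ∀ p ∈ Ω, angularD u p = 0) {p : Plane} (hp : p ∈ Ω) :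
    ∃ e : Plane, ‖e‖ = 1 ∧ ‖p‖ • e = p ∧ ∀ᶠ q in 𝓝 p, u q = u (‖q‖ • e) := by
  have hpolar : ∀ e z : ℂ, ‖e‖ = 1 → z = Complex.exp (Complex.arg (z / e) * Complex.I) * (‖z‖ • e) := by
    intro e z he
    have he0 : e ≠ 0 := by rintro rfl; simp at he
    have h := Complex.norm_mul_exp_arg_mul_I (z / e)
    rw [norm_div, he, div_one] at h
    rw [Complex.real_smul, mul_left_comm, ← mul_assoc, h, div_mul_cancel₀ _ he0]
  have key : ∀ e z : ℂ, ‖e‖ = 1 → (∀ t : ℝ, |t| ≤ |Complex.arg (z / e)| →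
      ofComplex (Complex.exp (t * Complex.I) * (‖z‖ • e)) ∈ Ω) →
      u (ofComplex z) = u (‖ofComplex z‖ • ofComplex e) := by
    intro e z he hin
    conv_lhs => rw [hpolar e z he]
    rw [eq_of_angularD_eq_zero (fun t ht => ⟨(hu _ (hin t ht)).differentiableAt, hrot _ (hin t ht)⟩),
      map_smul, LinearIsometryEquiv.norm_map]
  obtain ⟨z, rfl⟩ := ofComplex.surjective p
  by_cases hz : z = 0
  · subst hz
    refine ⟨ofComplex 1, by simp, by simp, ?_⟩
    -- Around the origin whole circles lie in `Ω`, so any unit vector serves.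
    rw [map_zero] at hp ⊢
    obtain ⟨r, hr, hb⟩ := Metric.isOpen_iff.1 hΩ 0 hp
    filter_upwards [Metric.ball_mem_nhds (0 : Plane) hr] with q hq
    obtain ⟨y, rfl⟩ := ofComplex.surjective q
    refine key 1 y (by simp) fun t _ => hb ?_
    rw [mem_ball_zero_iff, LinearIsometryEquiv.norm_map] at hq ⊢
    rw [norm_mul, Complex.norm_exp_ofReal_mul_I, norm_smul]
    simpa using hq
  · have hz0 : ‖z‖ ≠ 0 := norm_ne_zero_iff.2 hz
    set e : ℂ := ‖z‖⁻¹ • z with he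
    have hen : ‖e‖ = 1 := by
      rw [he, norm_smul, norm_inv, norm_norm, inv_mul_cancel₀ hz0]
    have hze : ‖z‖ • e = z := by rw [he, smul_smul, mul_inv_cancel₀ hz0, one_smul]
    have he0 : e ≠ 0 := by intro h0; simp [h0] at hen
    have hdiv : z / e = (‖z‖ : ℂ) := by
      rw [div_eq_iff he0, ← Complex.real_smul, hze]
    refine ⟨ofComplex e, by simpa using hen, by
      rw [LinearIsometryEquiv.norm_map, ← map_smul, hze], ?_⟩
    have hcont : Continuous fun x : ℝ × ℂ =>
        ofComplex (Complex.exp (x.1 * Complex.I) * (‖x.2‖ • e)) := by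
      fun_prop
    have hmem : ∀ᶠ x : ℝ × ℂ in 𝓝 (0, z),
        ofComplex (Complex.exp (x.1 * Complex.I) * (‖x.2‖ • e)) ∈ Ω := by
      refine hcont.continuousAt.eventually_mem (hΩ.mem_nhds ?_)
      simpa [hze] using hp
    rw [nhds_prod_eq, eventually_prod_iff] at hmem
    obtain ⟨P, hP, Q, hQ, hPQ⟩ := hmem
    obtain ⟨ε, hε, hPε⟩ := Metric.eventually_nhds_iff.1 hP
    -- For `y` near `z` the angle from `e` to `y` is small, so the arc from `‖y‖ e` to `y` stays in
    -- `Ω`.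
    have harg : ∀ᶠ y in 𝓝 z, |Complex.arg (y / e)| < ε := by
      have h1 : ContinuousAt (fun y : ℂ => Complex.arg (y / e)) z := by
        refine ContinuousAt.comp (g := Complex.arg) (Complex.continuousAt_arg ?_)
          (continuousAt_id.div_const e)
        rw [hdiv]
        exact Complex.ofReal_mem_slitPlane.2 (by positivity)
      have h2 : Complex.arg (z / e) = 0 := by
        rw [hdiv]
        exact Complex.arg_ofReal_of_nonneg (norm_nonneg _)
      exact h1.abs.eventually_lt_const (u := ε) (by simpa only [h2, abs_zero] using hε)
    have hnear : ∀ᶠ y in 𝓝 z, u (ofComplex y) = u (‖ofComplex y‖ • ofComplex e) := by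
      filter_upwards [harg, hQ] with y hy hyQ
      exact key e y hen fun t ht => hPQ (hPε (by
        rw [Real.dist_eq, sub_zero]; exact ht.trans_lt hy)) hyQ
    have := (ofComplex.symm.continuous.tendsto (ofComplex z))
    rw [LinearIsometryEquiv.symm_apply_apply] at this
    filter_upwards [this.eventually hnear] with q hq
    simpa using hq

theorem tendsto_smul_nhdsGT {p e : Plane} (he : ‖p‖ • e = p) :
    Tendsto (fun r : ℝ => r • e) (𝓝[>] ‖p‖) (𝓝 p) := by
  have : Tendsto (fun r : ℝ => r • e) (𝓝 ‖p‖) (𝓝 (‖p‖ • e)) :=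
    (continuous_id.smul continuous_const).tendsto _
  rw [he] at this
  exact this.mono_left nhdsWithin_le_nhds

/-- Only radii `r > ‖p‖` are compared, which also covers `p = 0`, where norms lie on one side; this
suffices for the identity theorem. -/
theorem frequently_eq_of_radial {u : Plane → ℝ} {p e : Plane} (hen : ‖e‖ = 1) (he : ‖p‖ • e = p)
    {f g : ℝ → ℝ} (hf : ∀ᶠ q in 𝓝 p, u q = f ‖q‖) (hg : ∀ᶠ q in 𝓝 p, u q = g ‖q‖) :
    ∃ᶠ r in 𝓝[≠] ‖p‖, f r = g r := by
  have h : ∀ᶠ r in 𝓝[>] ‖p‖, f r = g r := by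
    filter_upwards [(tendsto_smul_nhdsGT he).eventually hf, (tendsto_smul_nhdsGT he).eventually hg,
      self_mem_nhdsWithin] with r h1 h2 hr
    have hr0 : 0 ≤ r := (norm_nonneg p).trans (le_of_lt hr)
    rw [norm_smul, hen, mul_one, Real.norm_of_nonneg hr0] at h1 h2
    rw [← h1, h2]
  exact h.frequently.filter_mono (nhdsWithin_mono _ fun r hr => ne_of_gt hr)

/-- Around `p`, the function `u` is the analytic continuation of its radial profile at the
origin. -/
def HasProfile (u : Plane → ℝ) (p : Plane) : Prop :=
  ∃ (h : ℝ → ℝ) (ε R : ℝ), 0 < ε ∧ ‖p‖ < R ∧ AnalyticOnNhd ℝ h (Set.Ioo (-ε) R) ∧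
    (∀ᶠ q in 𝓝 0, u q = h ‖q‖) ∧ ∀ᶠ q in 𝓝 p, u q = h ‖q‖

theorem isOpen_hasProfile (u : Plane → ℝ) : IsOpen {p | HasProfile u p} := by
  rw [isOpen_iff_mem_nhds]
  rintro p ⟨h, ε, R, hε, hR, ha, h0, hp⟩
  filter_upwards [eventually_eventually_nhds.2 hp,
    continuous_norm.continuousAt.eventually_lt_const hR] with q hq hqR
  exact ⟨h, ε, R, hε, hqR, ha, h0, hq⟩

theorem analyticOnNhd_along_ray {Ω : Set Plane} {u : Plane → ℝ} (hu : AnalyticOnNhd ℝ u Ω)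
    {p e : Plane} (hen : ‖e‖ = 1) (he : ‖p‖ • e = p) {δ : ℝ} (hδ : Metric.ball p δ ⊆ Ω) :
    AnalyticOnNhd ℝ (fun r : ℝ => u (r • e)) (Set.Ioo (‖p‖ - δ) (‖p‖ + δ)) := by
  intro r hr
  have hmem : r • e ∈ Ω := by
    apply hδ
    have : r • e - p = (r - ‖p‖) • e := by rw [sub_smul, he]
    rw [mem_ball_iff_norm, this, norm_smul, hen, mul_one, Real.norm_eq_abs, abs_lt]
    constructor <;> linarith [hr.1, hr.2]
  have h1 : AnalyticAt ℝ (fun r : ℝ => r • e) r :=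
    ((ContinuousLinearMap.id ℝ ℝ).smulRight e).analyticAt r
  exact AnalyticAt.comp (hu _ hmem) h1

theorem hasProfile_zero {Ω : Set Plane} (hΩ : IsOpen Ω) {u : Plane → ℝ}
    (hu : AnalyticOnNhd ℝ u Ω) (hrot : ∀ p ∈ Ω, angularD u p = 0) (h0 : (0 : Plane) ∈ Ω) :
    HasProfile u 0 := by
  obtain ⟨e, hen, he, hev⟩ := eventually_eq_radial hΩ hu hrot h0
  obtain ⟨δ, hδ, hb⟩ := Metric.isOpen_iff.1 hΩ 0 h0
  have ha := analyticOnNhd_along_ray hu hen he hb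
  rw [norm_zero, zero_sub, zero_add] at ha
  exact ⟨_, δ, δ, hδ, by simpa using hδ, ha, hev, hev⟩

/-- A nearby point `p₁` carries a profile `h`, and `u` along the ray through `p` is a local profile
`g`. They agree near `‖p₁‖`, hence on the overlap of their intervals, and glue. -/
theorem hasProfile_of_mem_closure {Ω : Set Plane} (hΩ : IsOpen Ω) {u : Plane → ℝ}
    (hu : AnalyticOnNhd ℝ u Ω) (hrot : ∀ p ∈ Ω, angularD u p = 0) {p : Plane} (hp : p ∈ Ω)
    (hcl : p ∈ closure {p | HasProfile u p}) : HasProfile u p := by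
  obtain ⟨e, hen, he, hev⟩ := eventually_eq_radial hΩ hu hrot hp
  obtain ⟨δ, hδ, hb⟩ := Metric.eventually_nhds_iff_ball.1 (hev.and (hΩ.mem_nhds hp))
  obtain ⟨p₁, ⟨h, ε, R, hε, hR, ha, h0, hp₁⟩, hd⟩ := Metric.mem_closure_iff.1 hcl δ hδ
  rw [dist_comm] at hd
  obtain ⟨e₁, hen₁, he₁, -⟩ := eventually_eq_radial hΩ hu hrot (hb p₁ hd).2
  have hg := analyticOnNhd_along_ray hu hen he (fun q hq => (hb q hq).2)
  set g : ℝ → ℝ := fun r => u (r • e) with hgdef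
  have hgb : ∀ q ∈ Metric.ball p δ, u q = g ‖q‖ := fun q hq => (hb q hq).1
  have hJ : ∀ q ∈ Metric.ball p δ, ‖q‖ ∈ Set.Ioo (‖p‖ - δ) (‖p‖ + δ) := by
    intro q hq
    rw [mem_ball_iff_norm] at hq
    have h1 := abs_norm_sub_norm_le q p
    have h2 := abs_lt.1 (h1.trans_lt hq)
    constructor <;> linarith [h2.1, h2.2]
  have hI₁ : ‖p₁‖ ∈ Set.Ioo (-ε) R := ⟨by linarith [norm_nonneg p₁], hR⟩
  have hfreq := frequently_eq_of_radial hen₁ he₁ hp₁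
    (Filter.mem_of_superset (Metric.isOpen_ball.mem_nhds hd) hgb)
  have heq : Set.EqOn h g (Set.Ioo (-ε) R ∩ Set.Ioo (‖p‖ - δ) (‖p‖ + δ)) := by
    refine AnalyticOnNhd.eqOn_of_preconnected_of_frequently_eq
      (ha.mono Set.inter_subset_left) (hg.mono Set.inter_subset_right) ?_ ⟨hI₁, hJ p₁ hd⟩ hfreq
    rw [Set.Ioo_inter_Ioo]
    exact isPreconnected_Ioo
  classical
  set H : ℝ → ℝ := fun r => if r ∈ Set.Ioo (-ε) R then h r else g r with hH
  have hHI : ∀ r ∈ Set.Ioo (-ε) R, H r = h r := fun r hr => if_pos hr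
  have hHJ : ∀ r ∈ Set.Ioo (‖p‖ - δ) (‖p‖ + δ), H r = g r := by
    intro r hr
    by_cases hrI : r ∈ Set.Ioo (-ε) R
    · rw [hHI r hrI]; exact heq ⟨hrI, hr⟩
    · exact if_neg hrI
  have hI0 : ∀ᶠ q : Plane in 𝓝 0, ‖q‖ ∈ Set.Ioo (-ε) R := by
    filter_upwards [continuous_norm.continuousAt.eventually_lt_const
      (show ‖(0 : Plane)‖ < R by rw [norm_zero]; exact (norm_nonneg _).trans_lt hR)] with q hq
    exact ⟨by linarith [norm_nonneg q], hq⟩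
  refine ⟨H, ε, max R (‖p‖ + δ), hε, lt_max_of_lt_right (by linarith), ?_, ?_, ?_⟩
  · intro r hr
    by_cases hrI : r ∈ Set.Ioo (-ε) R
    · refine (ha r hrI).congr ?_
      filter_upwards [isOpen_Ioo.mem_nhds hrI] with s hs
      exact (hHI s hs).symm
    · have hRr : R ≤ r := by
        by_contra hlt
        exact hrI ⟨hr.1, not_le.1 hlt⟩
      have hrJ : r ∈ Set.Ioo (‖p‖ - δ) (‖p‖ + δ) := by
        refine ⟨by linarith [(hJ p₁ hd).1], ?_⟩
        exact (lt_max_iff.1 hr.2).resolve_left (not_lt.2 hRr)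
      refine (hg r hrJ).congr ?_
      filter_upwards [isOpen_Ioo.mem_nhds hrJ] with s hs
      exact (hHJ s hs).symm
  · filter_upwards [h0, hI0] with q hq hqI
    rw [hHI _ hqI, hq]
  · filter_upwards [Metric.ball_mem_nhds p hδ] with q hq
    rw [hHJ _ (hJ q hq), hgb q hq]

/-- An analytic function on a connected open neighbourhood of the origin whose angular derivative
vanishes is radial. -/
theorem exists_radial_profile {Ω : Set Plane} (hΩ : IsOpen Ω) (hΩc : IsConnected Ω)
    (h0 : (0 : Plane) ∈ Ω) {u : Plane → ℝ} (hu : AnalyticOnNhd ℝ u Ω)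
    (hrot : ∀ p ∈ Ω, angularD u p = 0) : ∃ h : ℝ → ℝ, ∀ p ∈ Ω, u p = h ‖p‖ := by
  -- The points with a profile form a relatively clopen subset of the connected set `Ω` containing
  -- the origin.
  have hall : Ω ⊆ {p | HasProfile u p} :=
    hΩc.isPreconnected.subset_of_closure_inter_subset (isOpen_hasProfile u)
      ⟨0, h0, hasProfile_zero hΩ hu hrot h0⟩
      (fun p hp => hasProfile_of_mem_closure hΩ hu hrot hp.2 hp.1)
  obtain ⟨e, hen, he, -⟩ := eventually_eq_radial hΩ hu hrot h0
  -- The profiles reaching `p` and `q` agree for small positive radii, both being that of `u` at the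
  -- origin, and hence up to the common norm.
  have huniq : ∀ p ∈ Ω, ∀ q ∈ Ω, ‖p‖ = ‖q‖ → u p = u q := by
    intro p hp q hq hpq
    obtain ⟨f, ε, R, hε, hR, hf, hf0, hfp⟩ := hall hp
    obtain ⟨g, ε', R', hε', hR', hg, hg0, hgq⟩ := hall hq
    have hfreq := frequently_eq_of_radial hen he hf0 hg0
    have heq : Set.EqOn f g (Set.Ioo (-ε) R ∩ Set.Ioo (-ε') R') := by
      refine AnalyticOnNhd.eqOn_of_preconnected_of_frequently_eq
        (hf.mono Set.inter_subset_left) (hg.mono Set.inter_subset_right) ?_ (z₀ := ‖(0 : Plane)‖) ?_ hfreq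
      · rw [Set.Ioo_inter_Ioo]
        exact isPreconnected_Ioo
      · rw [norm_zero]
        exact ⟨⟨by linarith, (norm_nonneg _).trans_lt hR⟩, ⟨by linarith, (norm_nonneg _).trans_lt hR'⟩⟩
    rw [hfp.self_of_nhds, hgq.self_of_nhds, hpq]
    exact heq ⟨⟨by linarith [norm_nonneg q], hpq ▸ hR⟩, ⟨by linarith [norm_nonneg q], hR'⟩⟩
  classical
  refine ⟨fun r => if h : ∃ q ∈ Ω, ‖q‖ = r then u h.choose else 0, fun p hp => ?_⟩
  have hex : ∃ q ∈ Ω, ‖q‖ = ‖p‖ := ⟨p, hp, rfl⟩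
  change u p = if h : ∃ q ∈ Ω, ‖q‖ = ‖p‖ then u h.choose else 0
  rw [dif_pos hex]
  exact huniq p hp _ hex.choose_spec.1 hex.choose_spec.2.symm

end GlobalRadiality

end RadialHessian

theorem mainTheorem4
    (Ω : Set RadialHessian.Plane) (hΩ : IsOpen Ω) (hΩc : IsConnected Ω)
    (h0 : (0 : RadialHessian.Plane) ∈ Ω)
    (u : RadialHessian.Plane → ℝ) (hu : AnalyticOnNhd ℝ u Ω)
    (hJ : ∀ p ∈ Ω, RadialHessian.jacobian (Laplacian.laplacian u)
      (RadialHessian.hessianDet u) p = 0)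
    (lam : ℝ) (k : ℕ) (hk : 3 ≤ k)
    (w : MvPolynomial (Fin 2) ℝ) (hw : w.IsHomogeneous k)
    (hharm : ¬ InnerProductSpace.HarmonicOnNhd (RadialHessian.polyFun w) Set.univ)
    (hlin : ¬ RadialHessian.IsMultipleOfLinearPower w k)
    (hexp : (fun p : RadialHessian.Plane =>
        u p - (lam / 2 * (p 0 ^ 2 + p 1 ^ 2) + RadialHessian.polyFun w p))
      =o[𝓝 0] (fun p : RadialHessian.Plane => ‖p‖ ^ k)) :
    ∃ h : ℝ → ℝ, ∀ p ∈ Ω, u p = h ‖p‖ := by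
  have hlap : Laplacian.laplacian u =ᶠ[𝓝 0] RadialHessian.lap u := by
    filter_upwards [hΩ.mem_nhds h0] with p hp
    exact RadialHessian.laplacian_eq (hu p hp)
  have hJ0 : RadialHessian.jacobian (RadialHessian.lap u) (RadialHessian.hessianDet u)
      =ᶠ[𝓝 0] 0 := by
    refine (RadialHessian.jacobian_congr hlap.symm (EventuallyEq.refl _ _)).trans ?_
    filter_upwards [hΩ.mem_nhds h0] with p hp
    exact hJ p hp
  have hev := RadialHessian.angularD_eventually_eq_zero (hu 0 h0) hJ0 lam hk hw hharm hlin hexp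
  -- The identity theorem carries the vanishing of `∂_θ u` from the origin to all of `Ω`.
  have hrot : Set.EqOn (RadialHessian.angularD u) 0 Ω :=
    AnalyticOnNhd.eqOn_zero_of_preconnected_of_eventuallyEq_zero
      (fun p hp => RadialHessian.angularD_analyticAt (hu p hp)) hΩc.isPreconnected h0 hev
  exact RadialHessian.exists_radial_profile hΩ hΩc h0 hu hrot
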